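/- Let $d>1$ and let $\mathcal A=\mathcal A_1\oplus\dots\oplus\mathcal A_d$ be a direct sum of unital simple $C^*$-algebras, with minimal central projections $p_1,\dots,p_d$. Let $X$ be a Hilbert bimodule over $\mathcal A$: a right Hilbert $\mathcal A$-module, with inner product $(\cdot\,|\,\cdot)_{\mathcal A}$, together with an isometric $*$-homomorphism $\phi:\mathcal A\to\mathcal L_{\mathcal A}(X)$ with $\phi(1)=1$ (the left action) into the adjointable operators. Assume that $X$ is full (the inner products span a dense subspace of $\mathcal A$) and finite projective (there is a finite basis, that is, $u_1,\dots,u_n\in X$ with $x=\sum_i u_i(u_i|x)_{\mathcal A}$ for all $x\in X$). Let $\mathcal O_X$ be the universal $C^*$-algebra generated by $\mathcal A$ and a linear copy of $X$ subject to $xa=x\cdot a$, $\phi(a)x=a\cdot x$, $x^*y=(x|y)_{\mathcal A}$ for $x,y\in X$, $a\in\mathcal A$, and $\sum_i u_iu_i^*=1$ for every finite basis $u_1,\dots,u_n$ of $X$. The tensor power $X^{\otimes k}$ over $\mathcal A$ is realized in $\mathcal O_X$ as the span $X^k$ of the products $x_1\cdots x_k$ (with $X^{\otimes 0}=\mathcal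 A$), and $\mathcal L_{\mathcal A}(X^{\otimes k})$ as $X^k(X^k)^*:=\operatorname{span}\{xy^*: x,y\in X^k\}\subseteq\mathcal O_X$. For $a$ in the center of $\mathcal A$ and $k\ge 0$ let $r_k(a)\in X^k(X^k)^*$ be the operator of right multiplication by $a$ on $X^{\otimes k}$, and put $r=r_1$. Let $A\in M_d(\{0,1\})$ be the matrix with $A(i,j)=1$ if $\phi(p_i)r(p_j)\neq 0$ in $\mathcal L_{\mathcal A}(X)$ and $A(i,j)=0$ otherwise. Let $\mathcal D_A$ be the $C^*$-subalgebra of $\mathcal O_X$ generated by all $r_k(p_i)$, $i=1,\dots,d$, $k=0,1,2,\dots$. For a finite basis $u_1,\dots,u_n$ of $X$ put $\sigma(T)=\sum_i u_iTu_i^*$, $T\in\mathcal O_X$. Then $\mathcal D_A$ is commutative, the space $$\xi_A=\{(x_k)_{k\ge 1}: x_k\in\{1,\dots,d\},\ A(x_k,x_{k+1})=1\ \text{for all }k\}$$ with the topology induced by the product topology is compact, and there is a homeomorphism from $\xi_A$ onto the spectrum (character space) of $\mathcal D_A$ under which 1. each $p_i$ lies in $\mathcal D_A$ and corresponds to the characteristic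 function of $Z(i)=\{(x_k)\in\xi_A: x_1=i\}$; 2. for every finite basis of $X$, $\sigma$ maps $\mathcal D_A$ into itself and acts on $\xi_A$ as the one-sided left shift: if $T\in\mathcal D_A$ corresponds to the function $f$ on $\xi_A$, then $\sigma(T)$ corresponds to the function $(x_1,x_2,\dots)\mapsto f(x_2,x_3,\dots)$. -/

import Mathlib

open scoped ENNReal

universe u v

/-- A (unital) C⋆-algebra is simple if it is nonzero and has no closed two-sided ideals
other than `0` and the whole algebra. -/
def IsSimpleCStarAlgebra (A : Type u) [CStarAlgebra A] : Prop :=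
  Nontrivial A ∧ ∀ I : TwoSidedIdeal A, IsClosed (I : Set A) → I = ⊥ ∨ I = ⊤

/-- A Hilbert bimodule over a unital C⋆-algebra `A`: a right Hilbert `A`-module `X`
(the right action `x a` is `MulOpposite.op a • x`) with `A`-valued inner product
`inn x y = (x | y)`, conjugate linear in `x` and linear in `y`, together with a left action
`φ(a) x = a • x` by adjointable operators with `φ(a)⋆ = φ(a⋆)`, where `φ` is one to one.
(An injective `⋆`-homomorphism of C⋆-algebras is automatically isometric. Completeness of `X`
is a separate type class. Mathlib's `CStarModule` is the left-handed version of the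
inner product structure: there `⟪x, a • y⟫ = a * ⟪x, y⟫`.) -/
class HilbertBimodule (A : Type u) (X : Type v) [CStarAlgebra A] [NormedAddCommGroup X]
    [NormedSpace ℂ X] [Module A X] [Module Aᵐᵒᵖ X] where
  /-- the `A`-valued inner product -/
  inn : X → X → A
  inn_add_right : ∀ x y z, inn x (y + z) = inn x y + inn x z
  inn_smul_right : ∀ (c : ℂ) x y, inn x (c • y) = c • inn x y
  inn_op_smul_right : ∀ (a : A) x y, inn x (MulOpposite.op a • y) = inn x y * a
  star_inn : ∀ x y, star (inn x y) = inn y x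
  inn_self_nonneg : ∀ x, ∃ a : A, inn x x = star a * a
  norm_sq_eq : ∀ x, ‖x‖ ^ 2 = ‖inn x x‖
  inn_smul_left : ∀ (a : A) x y, inn (a • x) y = inn x (star a • y)
  left_injective : ∀ a : A, (∀ x : X, a • x = 0) → a = 0

namespace HilbertBimodule

section Basic

variable (A : Type u) {X : Type v} [CStarAlgebra A] [NormedAddCommGroup X]
    [NormedSpace ℂ X] [Module A X] [Module Aᵐᵒᵖ X] [HilbertBimodule A X]

/-- A finite family `u` in `X` is a basis if `x = ∑ i, u i (u i | x)` for all `x`. -/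
def IsBasis {n : ℕ} (u : Fin n → X) : Prop :=
  ∀ x : X, x = ∑ i, MulOpposite.op (inn (u i) x : A) • u i

variable (X)

/-- `X` is finite projective as a right Hilbert module: it has a finite basis
(equivalently, it is an orthogonal direct summand of some `A ^ n`). -/
def FiniteProjective : Prop := ∃ (n : ℕ) (u : Fin n → X), IsBasis A u

/-- `X` is full: the inner products `(x | y)` span a dense subspace of `A`. -/
def Full : Prop :=
  Dense (Submodule.span ℂ {a : A | ∃ x y : X, a = inn x y} : Set A)

end Basic

/-- A representation, with support `1`, of the Hilbert bimodule `X` in a unital C⋆-algebra `D`. -/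
structure CovRep (A : Type u) (X : Type v) [CStarAlgebra A] [NormedAddCommGroup X]
    [NormedSpace ℂ X] [Module A X] [Module Aᵐᵒᵖ X] [HilbertBimodule A X] where
  /-- the target C⋆-algebra -/
  D : Type (max u v)
  [cstar : CStarAlgebra D]
  [nontriv : Nontrivial D]
  /-- the linear map `x ↦ V_x` -/
  V : X →ₗ[ℂ] D
  /-- the unital `⋆`-homomorphism of the coefficient algebra -/
  rho : A →⋆ₐ[ℂ] D
  V_right : ∀ x (a : A), V (MulOpposite.op a • x) = V x * rho a
  V_left : ∀ (a : A) x, V (a • x) = rho a * V x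
  V_inn : ∀ x y, star (V x) * V y = rho (inn x y)
  support_eq_one : ∀ (n : ℕ) (u : Fin n → X), IsBasis A u →
    ∑ i, V (u i) * star (V (u i)) = 1

attribute [instance] CovRep.cstar CovRep.nontriv

section CuntzPimsner

variable (A : Type u) (X : Type v) [CStarAlgebra A] [NormedAddCommGroup X]
    [NormedSpace ℂ X] [Module A X] [Module Aᵐᵒᵖ X] [HilbertBimodule A X]

variable {A X} in
theorem CovRep.norm_rho_le (R : CovRep A X) (a : A) : ‖R.rho a‖ ≤ ‖a‖ :=
  NonUnitalStarAlgHom.norm_apply_le R.rho a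

variable {A X} in
theorem CovRep.norm_V_le (R : CovRep A X) (x : X) : ‖R.V x‖ ≤ ‖x‖ := by
  have h : ‖R.V x‖ ^ 2 ≤ ‖x‖ ^ 2 := by
    rw [norm_sq_eq (A := A) x, sq, ← CStarRing.norm_star_mul_self, R.V_inn]
    exact R.norm_rho_le _
  exact (pow_le_pow_iff_left₀ (norm_nonneg _) (norm_nonneg _) two_ne_zero).1 h

/-- The C⋆-algebra of bounded families indexed by all representations of `X` with support `1`. -/
abbrev RepProd : Type (max u v + 1) := lp (fun R : CovRep A X => R.D) ∞

noncomputable instance : CStarAlgebra (RepProd A X) where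

variable {X} in
/-- The family `(V_x)` over all representations. -/
noncomputable def repProdV (x : X) : RepProd A X :=
  ⟨fun R => R.V x, memℓp_infty ⟨‖x‖, by rintro _ ⟨R, rfl⟩; exact R.norm_V_le x⟩⟩

variable {A} in
/-- The family `(ρ(a))` over all representations. -/
noncomputable def repProdRho (a : A) : RepProd A X :=
  ⟨fun R => R.rho a, memℓp_infty ⟨‖a‖, by rintro _ ⟨R, rfl⟩; exact R.norm_rho_le a⟩⟩

/-- The C⋆-subalgebra underlying `𝒪_X`: generated by all `S_x` and by `A`. -/
noncomputable def cuntzPimsnerSubalgebra : StarSubalgebra ℂ (RepProd A X) :=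
  (StarAlgebra.adjoin ℂ (Set.range (repProdV A : X → RepProd A X) ∪
    Set.range (repProdRho X : A → RepProd A X))).topologicalClosure

instance : IsClosed (cuntzPimsnerSubalgebra A X : Set (RepProd A X)) :=
  StarSubalgebra.isClosed_topologicalClosure _

/-- The C⋆-algebra `𝒪_X`: the universal C⋆-algebra generated by a representation of the
Hilbert bimodule `X` with support `1`. It is generated inside the product of all such
representations (by the universe of `A` and `X` it is enough to use C⋆-algebras in that universe,
since the image of a representation generates a C⋆-algebra of bounded cardinality). -/
def CuntzPimsner : Type (max u v + 1) := cuntzPimsnerSubalgebra A X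

namespace CuntzPimsner

noncomputable instance : CStarAlgebra (CuntzPimsner A X) :=
  inferInstanceAs (CStarAlgebra (cuntzPimsnerSubalgebra A X))

variable {A X} in
/-- The `R`-th coordinate: the `⋆`-homomorphism of `𝒪_X` induced by the representation `R`. -/
noncomputable def proj (R : CovRep A X) : CuntzPimsner A X →⋆ₐ[ℂ] R.D where
  toFun T := T.1.1 R
  map_one' := rfl
  map_mul' _ _ := rfl
  map_zero' := rfl
  map_add' _ _ := rfl
  commutes' _ := rfl
  map_star' _ := rfl

variable {A X} in
theorem ext_proj {T T' : CuntzPimsner A X} (h : ∀ R, proj R T = proj R T') : T = T' :=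
  Subtype.ext (Subtype.ext (funext h))

variable {X} in
/-- The generators `S_x` of `𝒪_X`. -/
noncomputable def S : X →ₗ[ℂ] CuntzPimsner A X where
  toFun x := ⟨repProdV A x, StarSubalgebra.le_topologicalClosure _
    (StarAlgebra.subset_adjoin ℂ _ (Or.inl ⟨x, rfl⟩))⟩
  map_add' x y := ext_proj fun R => R.V.map_add x y
  map_smul' c x := ext_proj fun R => R.V.map_smul c x

variable {A} in
theorem repProdRho_mem (a : A) : repProdRho X a ∈ cuntzPimsnerSubalgebra A X :=
  StarSubalgebra.le_topologicalClosure _ (StarAlgebra.subset_adjoin ℂ _ (Or.inr ⟨a, rfl⟩))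

/-- The canonical `⋆`-homomorphism `A → 𝒪_X`. -/
noncomputable def coeff : A →⋆ₐ[ℂ] CuntzPimsner A X where
  toFun a := ⟨repProdRho X a, repProdRho_mem X a⟩
  map_one' := ext_proj fun R => map_one R.rho
  map_mul' a b := ext_proj fun R => map_mul R.rho a b
  map_zero' := ext_proj fun R => map_zero R.rho
  map_add' a b := ext_proj fun R => map_add R.rho a b
  commutes' c := ext_proj fun R => AlgHomClass.commutes R.rho c
  map_star' a := ext_proj fun R => map_star R.rho a

variable {A X}

@[simp] theorem proj_S (R : CovRep A X) (x : X) : proj R (S A x) = R.V x := rfl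

@[simp] theorem proj_coeff (R : CovRep A X) (a : A) : proj R (coeff A X a) = R.rho a := rfl

theorem S_right (x : X) (a : A) : S A (MulOpposite.op a • x) = S A x * coeff A X a :=
  ext_proj fun R => by simp [R.V_right]

theorem S_left (a : A) (x : X) : S A (a • x) = coeff A X a * S A x :=
  ext_proj fun R => by simp [R.V_left]

theorem S_inn (x y : X) : star (S A x) * S A y = coeff A X (inn x y) :=
  ext_proj fun R => by simp [R.V_inn, map_star]

theorem support_eq_one {n : ℕ} {u : Fin n → X} (hu : IsBasis A u) :
    ∑ i, S A (u i) * star (S A (u i)) = 1 :=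
  ext_proj fun R => by simp [R.support_eq_one n u hu, map_star]

variable (A X)

/-- `X^k ⊆ 𝒪_X`, the realization of the tensor power `X ⊗_A ⋯ ⊗_A X` (`k` factors) as the
span of the operator products `S_{x₁} ⋯ S_{x_k}`; the power with `k = 0` is `A`. -/
noncomputable def tensorPower : ℕ → Submodule ℂ (CuntzPimsner A X)
  | 0 => LinearMap.range (coeff A X).toAlgHom.toLinearMap
  | k + 1 => LinearMap.range (S A : X →ₗ[ℂ] CuntzPimsner A X) * tensorPower k

/-- `X^k (X^k)⋆ ⊆ 𝒪_X`, the realization of the algebra of adjointable operators on the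
`k`-th tensor power of `X`, acting on `X^k` by multiplication in `𝒪_X`; the operator
`θ_{x, y}` is `x y⋆`. -/
noncomputable def tensorOps (k : ℕ) : Submodule ℂ (CuntzPimsner A X) :=
  Submodule.span ℂ {T | ∃ x ∈ tensorPower A X k, ∃ y ∈ tensorPower A X k, T = x * star y}

variable {A}

/-- `T` is the operator on the `k`-th tensor power given by right multiplication by `a`. -/
def IsRightMul (k : ℕ) (a : A) (T : CuntzPimsner A X) : Prop :=
  T ∈ tensorOps A X k ∧ ∀ x ∈ tensorPower A X k, T * x = x * coeff A X a

open Classical in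
/-- `r_k(a)`: the right multiplication by `a` on the `k`-th tensor power of `X`, regarded as an
element of `𝒪_X`. It exists and is unique for central `a`, see `existsUnique_isRightMul`. -/
noncomputable def r (k : ℕ) (a : A) : CuntzPimsner A X :=
  if h : ∃ T, IsRightMul X k a T then h.choose else 0

variable {X}

theorem IsRightMul.unique {k : ℕ} {a : A} {T T' : CuntzPimsner A X}
    (h : IsRightMul X k a T) (h' : IsRightMul X k a T') : T = T' := by
  have hm : T - T' ∈ tensorOps A X k := sub_mem h.1 h'.1
  have h0 : ∀ x ∈ tensorPower A X k, (T - T') * x = 0 := fun x hx => by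
    rw [sub_mul, h.2 x hx, h'.2 x hx, sub_self]
  have h1 : ∀ W ∈ tensorOps A X k, (T - T') * star W = 0 := by
    intro W hW
    induction hW using Submodule.span_induction with
    | mem W hW =>
      obtain ⟨x, _, y, hy, rfl⟩ := hW
      rw [star_mul, star_star, ← mul_assoc, h0 y hy, zero_mul]
    | zero => simp
    | add W W' _ _ hW hW' => rw [star_add, mul_add, hW, hW', add_zero]
    | smul c W _ hW => rw [star_smul, mul_smul_comm, hW, smul_zero]
  exact sub_eq_zero.1 ((CStarRing.mul_star_self_eq_zero_iff _).1 (h1 _ hm))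

theorem coeff_mul_mem (b : A) (k : ℕ) {x : CuntzPimsner A X} (hx : x ∈ tensorPower A X k) :
    coeff A X b * x ∈ tensorPower A X k := by
  cases k with
  | zero =>
    obtain ⟨c, rfl⟩ := hx
    exact ⟨b * c, map_mul (coeff A X) b c⟩
  | succ k =>
    rw [tensorPower] at hx ⊢
    induction hx using Submodule.mul_induction_on' with
    | mem_mul_mem s hs y hy =>
      obtain ⟨z, rfl⟩ := hs
      rw [← mul_assoc, ← S_left]
      exact Submodule.mul_mem_mul ⟨_, rfl⟩ hy
    | add y _ z _ hy hz => rw [mul_add]; exact add_mem hy hz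

theorem S_mul_mul_star_mem (z : X) {k : ℕ} {T : CuntzPimsner A X} (hT : T ∈ tensorOps A X k) :
    S A z * T * star (S A z) ∈ tensorOps A X (k + 1) := by
  induction hT using Submodule.span_induction with
  | mem T hT =>
    obtain ⟨x, hx, y, hy, rfl⟩ := hT
    refine Submodule.subset_span ⟨S A z * x, Submodule.mul_mem_mul ⟨z, rfl⟩ hx,
      S A z * y, Submodule.mul_mem_mul ⟨z, rfl⟩ hy, ?_⟩
    rw [star_mul]; simp only [mul_assoc]
  | zero => simp
  | add W W' _ _ hW hW' => rw [mul_add, add_mul]; exact add_mem hW hW'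
  | smul c W _ hW =>
    rw [mul_smul_comm, smul_mul_assoc]; exact Submodule.smul_mem _ c hW

theorem S_eq_sum {n : ℕ} {u : Fin n → X} (hu : IsBasis A u) (x : X) :
    S A x = ∑ i, S A (u i) * coeff A X (inn (u i) x) := by
  conv_lhs => rw [hu x]
  simp only [map_sum, S_right]

theorem exists_isRightMul (h : FiniteProjective A X) {a : A} (ha : a ∈ Set.center A) (k : ℕ) :
    ∃ T, IsRightMul X k a T := by
  obtain ⟨n, u, hu⟩ := h
  induction k with
  | zero =>
    refine ⟨coeff A X a, Submodule.subset_span ⟨_, ⟨a, rfl⟩, _, ⟨1, rfl⟩, ?_⟩, ?_⟩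
    · exact (by simp : coeff A X a = coeff A X a * star (coeff A X 1))
    · rintro _ ⟨b, rfl⟩
      change coeff A X a * coeff A X b = coeff A X b * coeff A X a
      rw [← map_mul, ← map_mul, (Set.mem_center_iff.1 ha).comm b]
  | succ k ih =>
    obtain ⟨T, hT, hTx⟩ := ih
    refine ⟨∑ i, S A (u i) * T * star (S A (u i)),
      Submodule.sum_mem _ fun i _ => S_mul_mul_star_mem _ hT, fun x hx => ?_⟩
    rw [tensorPower] at hx
    induction hx using Submodule.mul_induction_on' with
    | mem_mul_mem s hs y hy =>
      obtain ⟨z, rfl⟩ := hs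
      conv_rhs => rw [S_eq_sum hu z]
      rw [Finset.sum_mul, Finset.sum_mul, Finset.sum_mul]
      refine Finset.sum_congr rfl fun i _ => ?_
      calc S A (u i) * T * star (S A (u i)) * (S A z * y)
          = S A (u i) * (T * ((star (S A (u i)) * S A z) * y)) := by simp only [mul_assoc]
        _ = S A (u i) * (coeff A X (inn (u i) z) * y * coeff A X a) := by
            rw [S_inn, hTx _ (coeff_mul_mem _ k hy)]
        _ = _ := by simp only [mul_assoc]
    | add y _ z _ hy hz => rw [mul_add, add_mul, hy, hz]

theorem existsUnique_isRightMul (h : FiniteProjective A X) {a : A} (ha : a ∈ Set.center A)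
    (k : ℕ) : ∃! T, IsRightMul X k a T :=
  let ⟨T, hT⟩ := exists_isRightMul h ha k
  ⟨T, hT, fun _ h' => h'.unique hT⟩

theorem r_spec (h : FiniteProjective A X) {a : A} (ha : a ∈ Set.center A) (k : ℕ) :
    IsRightMul X k a (r X k a) := by
  rw [r, dif_pos (exists_isRightMul h ha k)]
  exact (exists_isRightMul h ha k).choose_spec

/-- The completely positive map `σ(T) = ∑ u_i T u_i⋆` of `𝒪_X` given by a finite family `u`
in `X`. For a basis `u`, its restriction to the relative commutant of `A` is an endomorphism
independent of `u`. -/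
noncomputable def sigma {n : ℕ} (u : Fin n → X) (T : CuntzPimsner A X) : CuntzPimsner A X :=
  ∑ i, S A (u i) * T * star (S A (u i))

end CuntzPimsner

end CuntzPimsner

end HilbertBimodule

/-! ### Cuntz–Krieger bimodules -/

namespace CuntzKriegerBimodule

open HilbertBimodule

variable {d : ℕ} (A : Fin d → Type u) [∀ i, CStarAlgebra (A i)]

/-- The minimal central projection `p_i` of `A_1 ⊕ ⋯ ⊕ A_d` (for simple `A_i`): the unit of the
`i`-th summand. -/
def p (i : Fin d) : Π i, A i := Pi.single i 1

section

variable (X : Type v) [NormedAddCommGroup X] [NormedSpace ℂ X] [Module (Π i, A i) X]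
  [Module (Π i, A i)ᵐᵒᵖ X]

open Classical in
/-- The `0`-`1` matrix of `X`: the entry `(i, j)` is `1` if the operator `φ(p_i) r(p_j)`,
`x ↦ p_i x p_j`, is nonzero, and `0` otherwise. -/
noncomputable def adjMatrix : Matrix (Fin d) (Fin d) ℕ := Matrix.of fun i j =>
  if ∃ x : X, p A i • (MulOpposite.op (p A j) • x) ≠ 0 then 1 else 0

end

/-- The one-sided Markov shift space of a `0`-`1` matrix `M`, with the topology induced by
the product of the discrete topologies (indices start at `0`). -/
def MarkovSpace (M : Matrix (Fin d) (Fin d) ℕ) : Type :=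
  {x : ℕ → Fin d // ∀ k, M (x k) (x (k + 1)) = 1}

instance (M : Matrix (Fin d) (Fin d) ℕ) : TopologicalSpace (MarkovSpace M) :=
  inferInstanceAs (TopologicalSpace {x : ℕ → Fin d // ∀ k, M (x k) (x (k + 1)) = 1})

/-- The one-sided left shift `(x_k)_k ↦ (x_{k+1})_k`. -/
def MarkovSpace.shift {M : Matrix (Fin d) (Fin d) ℕ} (x : MarkovSpace M) : MarkovSpace M :=
  ⟨fun k => x.1 (k + 1), fun k => x.2 (k + 1)⟩

/-- The cylinder set of all sequences that start with `i`. -/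
def MarkovSpace.cylinder (M : Matrix (Fin d) (Fin d) ℕ) (i : Fin d) : Set (MarkovSpace M) :=
  {x | x.1 0 = i}

/-- `𝒟_A`: the C⋆-subalgebra of `𝒪_X` generated by all `r_k(p_i)`. -/
noncomputable def diagonal (X : Type v) [NormedAddCommGroup X] [NormedSpace ℂ X]
    [Module (Π i, A i) X] [Module (Π i, A i)ᵐᵒᵖ X] [HilbertBimodule (Π i, A i) X] :
    StarSubalgebra ℂ (CuntzPimsner (Π i, A i) X) :=
  (StarAlgebra.adjoin ℂ {T | ∃ (k : ℕ) (i : Fin d),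
    T = CuntzPimsner.r X k (p A i)}).topologicalClosure

end CuntzKriegerBimodule

/-! The projections `r_k(p_i)` commute, sum to `1` over `i` for each fixed `k`, and satisfy
`r_k(p_i) r_{k+1}(p_j) = 0` unless `A(i,j) = 1`. A character of `𝒟_A` takes the values `0` and `1`
on them, so for every `k` it selects exactly one index, and the selected indices form an admissible
sequence. This itinerary map is continuous, and injective because the projections generate `𝒟_A`. By
compactness it is onto once every finite product of projections along an admissible path is nonzero
(`exists_homeomorph_characterSpace`). The shift appears because `σ(r_k(a)) = r_{k+1}(a)` (`r_succ`);
on the commutant of the coefficient algebra `σ` is a `⋆`-endomorphism, being determined there by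
`σ(T) S_z = S_z T` (`sigma_mul_S`).

For the products to be nonzero, simplicity is used: the annihilator in `A_i` of `p_i X p_j ≠ 0` is a
proper closed ideal, so `A_i` acts faithfully (`exists_smul_ne_zero`). Hence one can choose vectors
with `S_{w_0} ⋯ S_{w_{N-1}} p_{x_N} ≠ 0`, and such a product is fixed by all the projections of the
path (`exists_r_p_mul_eq_self`). This needs the coefficient algebra to embed in `𝒪_X`
(`coeff_injective`), that is, a representation with support `1` in which a given `a ≠ 0` survives.

Such a representation comes from the Fock module. Creation operators satisfy all the relations there
except `∑ u_i u_i⋆ = 1`, which fails in degree `0`. Truncating to degrees at most `2i` turns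
operators into finite matrices over the coefficient algebra, at the price of a second defect in the
top degree. Take functionals concentrated in the middle degree `i` and let `i → ∞`: elements of the
generated `⋆`-algebra move degrees by a bounded amount, so the limit sees neither edge and the GNS
quotient restores all the relations. The element `a` survives because the left action is isometric
on each tensor power (`exists_middle_functional`, `exists_representation_of_functional`). -/

/-! ### Positive functionals, GNS representations and weak-⋆ limits. -/

open scoped ComplexOrder in
-- Adding imaginary scalars to a self-adjoint `x` forces `f x` to be real. For `a ≥ 0` the bound
-- `‖‖a‖ - a‖ ≤ ‖a‖` then keeps `f a` in the right half-plane.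
theorem CStarAlgebra.apply_star_mul_self_nonneg_of_apply_one {B : Type*} [CStarAlgebra B]
    (f : StrongDual ℂ B) (hf : ‖f‖ ≤ 1) (h1 : f 1 = 1) (c : B) : 0 ≤ f (star c * c) := by
  let := CStarAlgebra.spectralOrder B
  have := CStarAlgebra.spectralOrderedRing B
  have bound : ∀ x : B, ‖f x‖ ≤ ‖x‖ := fun x => by
    simpa using f.le_of_opNorm_le hf x
  have him : ∀ x : B, IsSelfAdjoint x → (f x).im = 0 := by
    intro x hx
    -- This is `|f(x + it)|² ≤ ‖x + it‖² = ‖x² + t²‖`. The squares `t²` cancel, leaving a bound on a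
    -- function that is linear in `t`.
    have key : ∀ t : ℝ, ((f x).im + t) ^ 2 ≤ ‖x‖ ^ 2 + t ^ 2 := by
      intro t
      have e : star (x + algebraMap ℂ B (t * Complex.I)) * (x + algebraMap ℂ B (t * Complex.I))
          = x * x + algebraMap ℂ B (t ^ 2 : ℂ) := by
        rw [star_add, hx.star_eq, ← algebraMap_star_comm]
        have : star ((t : ℂ) * Complex.I) = -(t * Complex.I) := by simp
        rw [this]
        have c1 := Algebra.commutes ((t : ℂ) * Complex.I) x
        have c2 : algebraMap ℂ B (t ^ 2 : ℂ) =
            -(algebraMap ℂ B (t * Complex.I) * algebraMap ℂ B (t * Complex.I)) := by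
          rw [← map_mul, ← map_neg]; congr 1; ring_nf; simp
        rw [c2, map_neg, add_mul, mul_add, mul_add, ← c1]; noncomm_ring
      have h2 : ‖f (x + algebraMap ℂ B (t * Complex.I))‖ ^ 2 ≤ ‖x‖ ^ 2 + t ^ 2 := by
        calc _ ≤ ‖x + algebraMap ℂ B (t * Complex.I)‖ ^ 2 := by gcongr; exact bound _
          _ = ‖x * x + algebraMap ℂ B (t ^ 2 : ℂ)‖ := by
            rw [sq, ← CStarRing.norm_star_mul_self, e]
          _ ≤ ‖x * x‖ + ‖algebraMap ℂ B (t ^ 2 : ℂ)‖ := norm_add_le _ _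
          _ ≤ ‖x‖ ^ 2 + t ^ 2 := by
            gcongr
            · rw [sq]; exact norm_mul_le _ _
            · rcases subsingleton_or_nontrivial B with h | h
              · rw [Subsingleton.elim (algebraMap ℂ B (t ^ 2 : ℂ)) 0, norm_zero]; positivity
              · rw [norm_algebraMap']; simp
      have h3 : f (x + algebraMap ℂ B (t * Complex.I)) = f x + t * Complex.I := by
        rw [map_add, Algebra.algebraMap_eq_smul_one, map_smul, h1, smul_eq_mul, mul_one]
      rw [h3, ← Complex.normSq_eq_norm_sq, Complex.normSq_apply] at h2
      simp at h2
      nlinarith [mul_self_nonneg (f x).re]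
    by_contra h
    -- This `t` makes the cross term `2 t Im f(x)` equal to `‖x‖² + 1`, which exceeds the bound.
    have := key ((‖x‖ ^ 2 + 1) / (2 * (f x).im))
    have e : 2 * (f x).im * ((‖x‖ ^ 2 + 1) / (2 * (f x).im)) = ‖x‖ ^ 2 + 1 := by field_simp
    nlinarith [sq_nonneg (f x).im]
  rw [Complex.nonneg_iff]
  refine ⟨?_, (him _ (IsSelfAdjoint.star_mul_self c)).symm⟩
  set a := star c * c with ha
  have h0 : 0 ≤ a := star_mul_self_nonneg c
  rcases eq_or_ne a 0 with h | h
  · simp [h]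
  have hn : 0 < ‖a‖ := norm_pos_iff.2 h
  have h4 : ‖algebraMap ℝ B ‖a‖ - a‖ ≤ ‖a‖ := by
    have h5 : 0 ≤ algebraMap ℝ B ‖a‖ - a :=
      sub_nonneg.2 (IsSelfAdjoint.le_algebraMap_norm_self (.of_nonneg h0))
    rw [CStarAlgebra.norm_le_iff_le_algebraMap _ hn.le h5]
    exact sub_le_self _ h0
  have h6 := (bound _).trans h4
  have h7 : f (algebraMap ℝ B ‖a‖ - a) = ‖a‖ - f a := by
    rw [map_sub, IsScalarTower.algebraMap_apply ℝ ℂ B, Algebra.algebraMap_eq_smul_one, map_smul, h1]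
    simp
  rw [h7] at h6
  have := (Complex.re_le_norm _).trans h6
  simp at this
  linarith

/-- Every element of a C⋆-algebra has its norm detected by a positive contractive functional. -/
theorem CStarAlgebra.exists_positive_dual {B : Type*} [CStarAlgebra B] (b : B) :
    ∃ f : StrongDual ℂ B, ‖f‖ ≤ 1 ∧ (∀ c, ∃ t : ℝ, 0 ≤ t ∧ f (star c * c) = t) ∧
      f (star b * b) = ((‖b‖ ^ 2 : ℝ) : ℂ) := by
  let := CStarAlgebra.spectralOrder B
  have := CStarAlgebra.spectralOrderedRing B
  rcases eq_or_ne b 0 with rfl | hb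
  · exact ⟨0, by simp, fun c => ⟨0, le_rfl, by simp⟩, by simp⟩
  have : Nontrivial B := ⟨⟨b, 0, hb⟩⟩
  set x := star b * b with hx
  have hn : ‖x‖ = ‖b‖ ^ 2 := by rw [hx, CStarRing.norm_star_mul_self, sq]
  have hpos : 0 < ‖x‖ := by rw [hn]; have := norm_pos_iff.2 hb; positivity
  have h0 : 0 ≤ x := star_mul_self_nonneg b
  obtain ⟨f, hf, hfx⟩ := exists_dual_vector ℂ x hpos.ne'
  have hfx' : f x = ((‖x‖ : ℝ) : ℂ) := hfx
  have bound : ∀ x : B, ‖f x‖ ≤ ‖x‖ := fun x => by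
    simpa using f.le_of_opNorm_le hf.le x
  -- A functional norming the positive element `x` is unital: `0 ≤ x ≤ ‖x‖` gives `‖2x - ‖x‖‖ ≤
  -- ‖x‖`, hence `|2 - f 1| ≤ 1`. Together with `|f 1| ≤ 1` this leaves only `f 1 = 1`.
  have h1 : f 1 = 1 := by
    have hle : x ≤ algebraMap ℝ B ‖x‖ := IsSelfAdjoint.le_algebraMap_norm_self (.of_nonneg h0)
    have h2 : ‖x + x - algebraMap ℝ B ‖x‖‖ ≤ ‖x‖ := by
      have e : x + x - algebraMap ℝ B ‖x‖ = cfc (fun t : ℝ => t + t - ‖x‖) x := by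
        rw [cfc_sub (fun t : ℝ => t + t) (fun _ => ‖x‖) x, cfc_add x (fun t : ℝ => t) (fun t => t),
          cfc_id' ℝ x, cfc_const _ x]
      rw [e]
      refine norm_cfc_le hpos.le fun t ht => ?_
      have ht0 : 0 ≤ t := spectrum_nonneg_of_nonneg h0 ht
      have ht1 : t ≤ ‖x‖ := (Real.le_norm_self t).trans (spectrum.norm_le_norm_of_mem ht)
      rw [Real.norm_eq_abs, abs_le]
      constructor <;> linarith
    have h3 : f (x + x - algebraMap ℝ B ‖x‖) = ‖x‖ * (2 - f 1) := by
      rw [map_sub, map_add, hfx', IsScalarTower.algebraMap_apply ℝ ℂ B,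
        Algebra.algebraMap_eq_smul_one, map_smul]
      simp; ring
    have h4 := (bound _).trans h2
    rw [h3, norm_mul] at h4
    have h5 : ‖2 - f 1‖ ≤ 1 := by
      rw [Complex.norm_real, norm_norm] at h4
      exact (mul_le_iff_le_one_right hpos).1 h4
    have h6 : ‖f 1‖ ≤ 1 := (bound 1).trans (by simp)
    have e5 : ‖2 - f 1‖ ^ 2 ≤ 1 := pow_le_one₀ (norm_nonneg _) h5
    have e6 : ‖f 1‖ ^ 2 ≤ 1 := pow_le_one₀ (norm_nonneg _) h6
    rw [← Complex.normSq_eq_norm_sq, Complex.normSq_apply] at e5 e6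
    simp at e5 e6
    have him : (f 1).im = 0 := by nlinarith [sq_nonneg ((f 1).re - 1)]
    have hre : (f 1).re = 1 := by nlinarith [sq_nonneg ((f 1).re - 1)]
    exact Complex.ext (by simpa using hre) (by simpa using him)
  refine ⟨f, hf.le, fun c => ?_, by rw [hfx', hn]⟩
  have := CStarAlgebra.apply_star_mul_self_nonneg_of_apply_one f hf.le h1 c
  rw [Complex.nonneg_iff] at this
  exact ⟨_, this.1, Complex.ext rfl (by simpa using this.2.symm)⟩

open scoped ComplexOrder in
/-- GNS: a positive functional yields a representation whose kernel is read off the functional. -/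
theorem CStarAlgebra.exists_gns {B : Type u} [CStarAlgebra B] (φ : StrongDual ℂ B)
    (hφ : ∀ b, ∃ t : ℝ, 0 ≤ t ∧ φ (star b * b) = t) :
    ∃ (D : Type u) (_ : CStarAlgebra D) (π : B →⋆ₐ[ℂ] D),
      ∀ R, π R = 0 ↔ ∀ b, φ (star (R * b) * (R * b)) = 0 := by
  let := CStarAlgebra.spectralOrder B
  have := CStarAlgebra.spectralOrderedRing B
  let f : B →ₚ[ℂ] ℂ := PositiveLinearMap.mk₀ φ.toLinearMap (fun x hx => by
    obtain ⟨b, rfl⟩ := CStarAlgebra.nonneg_iff_eq_star_mul_self.1 hx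
    obtain ⟨t, ht, e⟩ := hφ b
    change 0 ≤ φ _
    rw [e]; exact_mod_cast ht)
  have hfφ : ∀ b, f b = φ b := fun _ => rfl
  refine ⟨f.GNS →L[ℂ] f.GNS, inferInstance, f.gnsStarAlgHom, fun R => ⟨fun h b => ?_, fun h => ?_⟩⟩
  · have h1 : f.gnsStarAlgHom R (f.toPreGNS b : f.GNS) = 0 := by rw [h]; rfl
    have h2 : ((f.leftMulMapPreGNS R (f.toPreGNS b) : f.PreGNS) : f.GNS) = 0 := by
      rw [← h1]; exact (f.gnsNonUnitalStarAlgHom_apply_coe).symm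
    have h3 : ‖(f.leftMulMapPreGNS R (f.toPreGNS b) : f.PreGNS)‖ = 0 := by
      rw [← UniformSpace.Completion.norm_coe, h2, norm_zero]
    have h4 := f.preGNS_norm_sq (f.leftMulMapPreGNS R (f.toPreGNS b))
    rw [h3] at h4
    simpa [hfφ] using h4.symm
  · ext y
    induction y using UniformSpace.Completion.induction_on with
    | hp => exact isClosed_eq (ContinuousLinearMap.continuous _) (by fun_prop)
    | ih y =>
      have h1 : f.gnsStarAlgHom R (y : f.GNS) = ((f.leftMulMapPreGNS R y : f.PreGNS) : f.GNS) :=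
        f.gnsNonUnitalStarAlgHom_apply_coe
      rw [h1]
      have h4 := f.preGNS_norm_sq (f.leftMulMapPreGNS R y)
      have h5 := h (f.ofPreGNS y)
      rw [← hfφ] at h5
      have h6 : ‖f.leftMulMapPreGNS R y‖ = 0 := by
        have : ((‖f.leftMulMapPreGNS R y‖ ^ 2 : ℝ) : ℂ) = 0 := by
          push_cast; rw [h4]; exact h5
        have := Complex.ofReal_eq_zero.1 this
        simpa using this
      rw [zero_apply, ← norm_eq_zero, UniformSpace.Completion.norm_coe, h6]

/-- Limits of a bounded family of functionals along a filter. -/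
theorem StrongDual.exists_limit {I E : Type*} [NormedAddCommGroup E] [NormedSpace ℂ E]
    (l : Filter I) [l.NeBot] (g : I → StrongDual ℂ E) (C : ℝ) (hg : ∀ i, ‖g i‖ ≤ C) :
    ∃ (U : Filter I) (φ : StrongDual ℂ E), U.NeBot ∧ U ≤ l ∧
      ∀ x, Filter.Tendsto (fun i => g i x) U (nhds (φ x)) := by
  let U := Ultrafilter.of l
  let G : I → WeakDual ℂ E := fun i => StrongDual.toWeakDual (g i)
  obtain ⟨φ, -, hφ⟩ := (WeakDual.isCompact_closedBall (𝕜 := ℂ) (E := E) 0 C).ultrafilter_le_nhds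
    (U.map G) (by
      rw [Filter.le_principal_iff]
      refine Filter.mem_map.2 (Filter.univ_mem' fun i => ?_)
      simpa [G] using hg i)
  refine ⟨U, WeakDual.toStrongDual φ, inferInstance, Ultrafilter.of_le l, fun x => ?_⟩
  have : Filter.Tendsto G U (nhds φ) := hφ
  exact ((WeakDual.eval_continuous x).tendsto φ).comp this

/-! ### Words of bounded length. -/

/-- The words of length at most `N` in the alphabet `Fin n`. -/
noncomputable def wordsUpTo (n : ℕ) : ℕ → Finset (List (Fin n))
  | 0 => {[]}
  | N + 1 => insert [] ((Finset.univ ×ˢ wordsUpTo n N).map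
      ⟨fun p => p.1 :: p.2, fun p q h => by
        rw [List.cons.injEq] at h; exact Prod.ext h.1 h.2⟩)

theorem mem_wordsUpTo {n N : ℕ} {w : List (Fin n)} : w ∈ wordsUpTo n N ↔ w.length ≤ N := by
  induction N generalizing w with
  | zero => simp [wordsUpTo]
  | succ N ih =>
    cases w with
    | nil => simp [wordsUpTo]
    | cons i w =>
      simp only [wordsUpTo, Finset.mem_insert, reduceCtorEq, false_or, Finset.mem_map,
        Finset.mem_product, Finset.mem_univ, true_and, List.length_cons, Nat.add_le_add_iff_right]
      refine ⟨?_, fun h => ⟨(i, w), ih.2 h, rfl⟩⟩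
      rintro ⟨p, hp, e⟩
      exact (List.cons.inj e).2 ▸ ih.1 hp

/-- Splitting off the first letter matches the recursion of `amp` and `creation`, so sums over words
are handled by induction on the truncation length. -/
theorem sum_wordsUpTo_succ {n N : ℕ} {M : Type*} [AddCommMonoid M] (f : List (Fin n) → M) :
    ∑ w ∈ wordsUpTo n (N + 1), f w = f [] + ∑ i, ∑ w ∈ wordsUpTo n N, f (i :: w) := by
  rw [wordsUpTo, Finset.sum_insert (by simp), Finset.sum_map, Finset.sum_product]
  rfl

/-! ### Matrix coefficients of the left action and of creation operators on tensor powers. -/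

namespace HilbertBimodule

variable {A : Type u} {X : Type v} [CStarAlgebra A] [NormedAddCommGroup X]
    [NormedSpace ℂ X] [Module A X] [Module Aᵐᵒᵖ X] [HilbertBimodule A X]

variable (A) in
/-- The inner product with a fixed first argument. -/
noncomputable def innRight (x : X) : X →ₗ[ℂ] A where
  toFun := inn x
  map_add' := inn_add_right x
  map_smul' c y := inn_smul_right c x y

@[simp] theorem innRight_apply (x y : X) : innRight A x y = inn x y := rfl

theorem inn_sum_right {ι : Type*} (s : Finset ι) (x : X) (f : ι → X) :
    (inn x (∑ i ∈ s, f i) : A) = ∑ i ∈ s, inn x (f i) :=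
  map_sum (innRight A x) f s

theorem inn_eq_sum {n : ℕ} {v : Fin n → X} (hv : IsBasis A v) (x y : X) :
    (inn x y : A) = ∑ k, inn x (v k) * inn (v k) y := by
  conv_lhs => rw [hv y]
  simp only [inn_sum_right, inn_op_smul_right]

theorem inn_smul_eq_sum [SMulCommClass A Aᵐᵒᵖ X] {n : ℕ} {v : Fin n → X} (hv : IsBasis A v)
    (a : A) (x y : X) : (inn x (a • y) : A) = ∑ k, inn x (a • v k) * inn (v k) y := by
  conv_lhs => rw [hv y]
  simp only [Finset.smul_sum, inn_sum_right, smul_comm a (MulOpposite.op _), inn_op_smul_right]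

section Amplification

variable [IsScalarTower ℂ A X] {n : ℕ} (u : Fin n → X)

/-- The matrix coefficients `(u_w | a u_w')` of the left action on all tensor powers, with
respect to the elementary tensors `u_w = u_{w₁} ⊗ ⋯ ⊗ u_{w_k}`. -/
noncomputable def amp : List (Fin n) → List (Fin n) → A →ₗ[ℂ] A
  | [], [] => LinearMap.id
  | i :: w, j :: w' => amp w w' ∘ₗ
      { toFun a := inn (u i) (a • u j)
        map_add' a b := by rw [add_smul, inn_add_right]
        map_smul' c a := by rw [smul_assoc, inn_smul_right]; rfl }
  | _, _ => 0

@[simp] theorem amp_nil_nil (a : A) : amp u [] [] a = a := rfl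

@[simp] theorem amp_cons_cons (i j : Fin n) (w w' : List (Fin n)) (a : A) :
    amp u (i :: w) (j :: w') a = amp u w w' (inn (u i) (a • u j)) := rfl

@[simp] theorem amp_nil_cons (j : Fin n) (w' : List (Fin n)) (a : A) :
    amp u [] (j :: w') a = 0 := rfl

@[simp] theorem amp_cons_nil (i : Fin n) (w : List (Fin n)) (a : A) :
    amp u (i :: w) [] a = 0 := rfl

theorem amp_eq_zero {w w' : List (Fin n)} (h : w.length ≠ w'.length) (a : A) :
    amp u w w' a = 0 := by
  induction w generalizing w' a with
  | nil => cases w' <;> simp_all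
  | cons i w ih =>
    cases w' with
    | nil => rfl
    | cons j w' => exact ih (by simpa using h) _

theorem star_amp (w w' : List (Fin n)) (a : A) : star (amp u w w' a) = amp u w' w (star a) := by
  induction w generalizing w' a with
  | nil => cases w' <;> simp
  | cons i w ih =>
    cases w' with
    | nil => simp
    | cons j w' => rw [amp_cons_cons, ih, star_inn, inn_smul_left, amp_cons_cons]

variable {u}

/-- The left action is faithful on every tensor power: by induction all `(u_i | a u_j)` vanish, so
`a` kills the basis, hence `X`, and `left_injective` applies. -/
theorem eq_zero_of_amp_eq_zero [SMulCommClass A Aᵐᵒᵖ X] (hu : IsBasis A u) (m : ℕ) {a : A}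
    (h : ∀ w w', w.length = m → w'.length = m → amp u w w' a = 0) : a = 0 := by
  induction m generalizing a with
  | zero => exact h [] [] rfl rfl
  | succ m ih =>
    have h1 : ∀ i j, (inn (u i) (a • u j) : A) = 0 := fun i j =>
      ih fun w w' hw hw' => h (i :: w) (j :: w') (by simp [hw]) (by simp [hw'])
    have h2 : ∀ j, a • u j = 0 := fun j => by
      rw [hu (a • u j)]; simp [h1]
    refine left_injective (X := X) a fun x => ?_
    rw [hu x, Finset.smul_sum]
    exact Finset.sum_eq_zero fun k _ => by rw [smul_comm, h2, smul_zero]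

/-- Peeling off first letters leaves the product `(u_i | a u_k)(u_k | b u_j)` as the argument of
`amp`; summing over `k` inside the linear map `amp u w w'` gives `(u_i | ab u_j)` by the basis
expansion. Only words as long as `w` contribute, so the truncation at `N` loses nothing. -/
theorem sum_amp_mul_amp_of_left [SMulCommClass A Aᵐᵒᵖ X] (hu : IsBasis A u) {N : ℕ}
    {w : List (Fin n)} (w' : List (Fin n)) (hw : w.length ≤ N) (a b : A) :
    ∑ v ∈ wordsUpTo n N, amp u w v a * amp u v w' b = amp u w w' (a * b) := by
  induction N generalizing w w' a b with
  | zero =>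
    obtain rfl : w = [] := by simpa using hw
    cases w' <;> simp [wordsUpTo]
  | succ N ih =>
    rw [sum_wordsUpTo_succ]
    cases w with
    | nil => cases w' <;> simp
    | cons i w =>
      cases w' with
      | nil => simp
      | cons j w' =>
        simp only [amp_cons_cons, amp_cons_nil, zero_mul, zero_add]
        simp_rw [ih w' (by simpa using hw)]
        rw [← map_sum, mul_smul, inn_smul_eq_sum hu]

theorem sum_amp_mul_amp [SMulCommClass A Aᵐᵒᵖ X] (hu : IsBasis A u) {N : ℕ}
    {w w' : List (Fin n)} (hw : w.length ≤ N ∨ w'.length ≤ N) (a b : A) :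
    ∑ v ∈ wordsUpTo n N, amp u w v a * amp u v w' b = amp u w w' (a * b) := by
  rcases hw with hw | hw
  · exact sum_amp_mul_amp_of_left hu w' hw a b
  · apply star_injective
    rw [star_amp, star_mul, ← sum_amp_mul_amp_of_left hu w hw, star_sum]
    simp only [star_mul, star_amp]

variable (u)

/-- The matrix coefficients `(u_w | x ⊗ u_w')` of the creation operators. -/
noncomputable def creation : List (Fin n) → List (Fin n) → X →ₗ[ℂ] A
  | [], _ => 0
  | i :: w, w' => amp u w w' ∘ₗ innRight A (u i)

@[simp] theorem creation_nil (w' : List (Fin n)) (x : X) : creation (A := A) u [] w' x = 0 := rfl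

@[simp] theorem creation_cons (i : Fin n) (w w' : List (Fin n)) (x : X) :
    creation u (i :: w) w' x = amp u w w' (inn (u i) x : A) := rfl

theorem creation_eq_zero {w w' : List (Fin n)} (h : w.length ≠ w'.length + 1) (x : X) :
    creation (A := A) u w w' x = 0 := by
  cases w with
  | nil => rfl
  | cons i w => exact amp_eq_zero u (by simpa using h) _

variable {u}
variable [SMulCommClass A Aᵐᵒᵖ X]

theorem sum_creation_mul_amp (hu : IsBasis A u) {N : ℕ} {w w' : List (Fin n)}
    (hw' : w'.length ≤ N) (x : X) (a : A) :
    ∑ v ∈ wordsUpTo n N, creation u w v x * amp u v w' a =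
      creation u w w' (MulOpposite.op a • x) := by
  cases w with
  | nil => simp
  | cons i w => simp only [creation_cons, sum_amp_mul_amp hu (.inr hw'), inn_op_smul_right]

theorem sum_amp_mul_creation (hu : IsBasis A u) {N : ℕ} {w w' : List (Fin n)}
    (hw : w.length ≤ N) (x : X) (a : A) :
    ∑ v ∈ wordsUpTo n N, amp u w v a * creation u v w' x = creation u w w' (a • x) := by
  cases N with
  | zero =>
    obtain rfl : w = [] := by simpa using hw
    simp [wordsUpTo]
  | succ N =>
    rw [sum_wordsUpTo_succ]
    cases w with
    | nil => simp
    | cons i w =>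
      simp only [amp_cons_cons, creation_cons, creation_nil, mul_zero, zero_add]
      simp_rw [sum_amp_mul_amp hu (.inl (show w.length ≤ N by simpa using hw))]
      rw [← map_sum, ← inn_smul_eq_sum hu]

/-- The inequality is strict because creation raises the degree by one: the intermediate words of
length `w'.length + 1` must still lie within the truncation. -/
theorem sum_star_creation_mul_creation (hu : IsBasis A u) {N : ℕ} {w w' : List (Fin n)}
    (hw' : w'.length < N) (x y : X) :
    ∑ v ∈ wordsUpTo n N, star (creation (A := A) u v w x) * creation u v w' y =
      amp u w w' (inn x y : A) := by
  obtain ⟨N, rfl⟩ : ∃ k, N = k + 1 := ⟨N - 1, by omega⟩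
  rw [sum_wordsUpTo_succ]
  simp only [creation_cons, creation_nil, mul_zero, zero_add, star_amp, star_inn]
  simp_rw [sum_amp_mul_amp hu (.inr (show w'.length ≤ N by omega))]
  rw [← map_sum, ← inn_eq_sum hu]

/-- The sum acts on the first tensor leg by `∑ θ_{x_k, x_k} = 1`. The empty word has no first leg,
and there the left side is zero while `amp u [] [] 1 = 1`. -/
theorem sum_creation_mul_star_creation (hu : IsBasis A u) {m : ℕ} {x : Fin m → X}
    (hx : IsBasis A x) {N : ℕ} {w w' : List (Fin n)} (hw : w.length ≤ N) (h0 : w' ≠ []) :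
    ∑ k, ∑ v ∈ wordsUpTo n N, creation (A := A) u w v (x k) * star (creation u w' v (x k)) =
      amp u w w' (1 : A) := by
  cases w with
  | nil => cases w' <;> simp at h0 ⊢
  | cons i w =>
    cases w' with
    | nil => simp at h0
    | cons j w' =>
      simp only [creation_cons, star_amp, star_inn]
      simp_rw [sum_amp_mul_amp hu (.inl (show w.length ≤ N by simp at hw; omega))]
      rw [← map_sum, ← inn_eq_sum hx, amp_cons_cons, one_smul]

end Amplification

end HilbertBimodule

/-! ### Operators on truncated Fock modules, as matrices over the coefficient algebra. -/

theorem length_le_of_wordsUpTo {n N : ℕ} (w : wordsUpTo n N) : w.1.length ≤ N :=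
  mem_wordsUpTo.1 w.2

namespace HilbertBimodule

variable {A : Type u} {X : Type v} [CStarAlgebra A] [NormedAddCommGroup X]
    [NormedSpace ℂ X] [Module A X] [Module Aᵐᵒᵖ X] [HilbertBimodule A X]

section Fock

variable [PartialOrder A] [StarOrderedRing A]

variable (A) in
/-- Matrices over `A` indexed by the words of length at most `N`, acting on the truncated Fock
module. -/
abbrev FockMatrix (n N : ℕ) : Type u := CStarMatrix (wordsUpTo n N) (wordsUpTo n N) A

variable [IsScalarTower ℂ A X] {n : ℕ} (u : Fin n → X) (N : ℕ)

/-- The left action on the truncated Fock module. -/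
noncomputable def fockLeft : A →ₗ[ℂ] FockMatrix A n N where
  toFun a := CStarMatrix.ofMatrix fun w w' => amp u w w' a
  map_add' a b := CStarMatrix.ext fun _ _ => LinearMap.map_add _ a b
  map_smul' c a := CStarMatrix.ext fun _ _ => LinearMap.map_smul _ c a

/-- The creation operators on the truncated Fock module. -/
noncomputable def fockCreate : X →ₗ[ℂ] FockMatrix A n N where
  toFun x := CStarMatrix.ofMatrix fun w w' => creation u w w' x
  map_add' a b := CStarMatrix.ext fun _ _ => LinearMap.map_add _ a b
  map_smul' c a := CStarMatrix.ext fun _ _ => LinearMap.map_smul _ c a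

open Classical in
variable (A) in
/-- The projection of the truncated Fock module to the degrees satisfying `P`. -/
noncomputable def fockCut (P : ℕ → Prop) : FockMatrix A n N :=
  CStarMatrix.ofMatrix fun w w' => if P w.1.length then amp u w w' 1 else 0

@[simp] theorem fockLeft_apply (a : A) (w w' : wordsUpTo n N) :
    fockLeft u N a w w' = amp u w w' a := rfl

@[simp] theorem fockCreate_apply (x : X) (w w' : wordsUpTo n N) :
    (fockCreate u N x : FockMatrix A n N) w w' = creation u w w' x := rfl

open Classical in
@[simp] theorem fockCut_apply (P : ℕ → Prop) (w w' : wordsUpTo n N) :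
    fockCut A u N P w w' = if P w.1.length then amp u w w' 1 else 0 := rfl

theorem FockMatrix.mul_apply (S T : FockMatrix A n N) (w w' : wordsUpTo n N) :
    (S * T) w w' = ∑ v, S w v * T v w' := CStarMatrix.mul_apply

theorem star_fockLeft (a : A) : star (fockLeft u N a) = fockLeft u N (star a) := by
  ext w w'
  rw [CStarMatrix.star_apply, fockLeft_apply, star_amp]; rfl

variable {u N}
variable [SMulCommClass A Aᵐᵒᵖ X]

theorem fockLeft_mul (hu : IsBasis A u) (a b : A) : fockLeft u N a * fockLeft u N b = fockLeft u N (a * b) := by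
  ext w w'
  rw [FockMatrix.mul_apply]
  simp only [fockLeft_apply]
  rw [← sum_amp_mul_amp hu (.inl (length_le_of_wordsUpTo w))]
  exact Finset.sum_coe_sort (wordsUpTo n N) fun v => amp u w v a * amp u v w' b

theorem fockCreate_mul_fockLeft (hu : IsBasis A u) (x : X) (a : A) :
    fockCreate u N x * fockLeft u N a = fockCreate u N (MulOpposite.op a • x) := by
  ext w w'
  rw [FockMatrix.mul_apply]
  simp only [fockLeft_apply, fockCreate_apply]
  rw [← sum_creation_mul_amp hu (length_le_of_wordsUpTo w')]
  exact Finset.sum_coe_sort (wordsUpTo n N) fun v => creation u w v x * amp u v w' a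

theorem fockLeft_mul_fockCreate (hu : IsBasis A u) (x : X) (a : A) :
    fockLeft u N a * fockCreate u N x = fockCreate u N (a • x) := by
  ext w w'
  rw [FockMatrix.mul_apply]
  simp only [fockLeft_apply, fockCreate_apply]
  rw [← sum_amp_mul_creation hu (length_le_of_wordsUpTo w)]
  exact Finset.sum_coe_sort (wordsUpTo n N) fun v => amp u w v a * creation u v w' x

open Classical in
theorem fockCut_mul_apply (hu : IsBasis A u) (P : ℕ → Prop) (T : FockMatrix A n N) (w w' : wordsUpTo n N) :
    (fockCut A u N P * T) w w' =
      if P w.1.length then (fockLeft u N 1 * T : FockMatrix A n N) w w' else 0 := by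
  rw [FockMatrix.mul_apply, FockMatrix.mul_apply]
  split_ifs with h <;> simp [h]

open Classical in
theorem mul_fockCut_apply (hu : IsBasis A u) (P : ℕ → Prop) (T : FockMatrix A n N) (w w' : wordsUpTo n N) :
    (T * fockCut A u N P) w w' =
      if P w'.1.length then (T * fockLeft u N 1 : FockMatrix A n N) w w' else 0 := by
  rw [FockMatrix.mul_apply, FockMatrix.mul_apply]
  have : ∀ v : wordsUpTo n N, fockCut A u N P v w' =
      if P w'.1.length then amp u v w' 1 else 0 := fun v => by
    rw [fockCut_apply]
    rcases eq_or_ne v.1.length w'.1.length with h | h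
    · rw [h]
    · simp [amp_eq_zero u h]
  simp only [this, fockLeft_apply]
  split_ifs with h <;> simp

open Classical in
theorem fockCut_mul_fockCut (hu : IsBasis A u) (P Q : ℕ → Prop) :
    fockCut A u N P * fockCut A u N Q = fockCut A u N fun k => P k ∧ Q k := by
  ext w w'
  rw [fockCut_mul_apply hu, mul_fockCut_apply hu, fockLeft_mul hu, fockCut_apply, mul_one,
    fockLeft_apply]
  rcases eq_or_ne w.1.length w'.1.length with h | h
  · rw [h]; split_ifs <;> tauto
  · simp [amp_eq_zero u h]

theorem star_fockCut (hu : IsBasis A u) (P : ℕ → Prop) : star (fockCut A u N P) = fockCut A u N P := by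
  ext w w'
  rw [CStarMatrix.star_apply, fockCut_apply, fockCut_apply, apply_ite star, star_amp, star_zero,
    star_one]
  rcases eq_or_ne w.1.length w'.1.length with h | h
  · rw [h]
  · simp [amp_eq_zero u h]

/-- The matrix `fockLeft u N 1` is in general not the identity but the Gram projection `(u_w |
u_w')`, which cuts the Fock module out of the free module on words; every `fockCut` lies below it.
-/
theorem fockLeft_one_mul_fockCut (hu : IsBasis A u) (P : ℕ → Prop) :
    fockLeft u N 1 * fockCut A u N P = fockCut A u N P := by
  ext w w'
  rw [mul_fockCut_apply hu, fockLeft_mul hu, mul_one, fockLeft_apply, fockCut_apply]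
  rcases eq_or_ne w.1.length w'.1.length with h | h
  · rw [h]
  · simp [amp_eq_zero u h]

theorem isStarProjection_fockCut (hu : IsBasis A u) (P : ℕ → Prop) : IsStarProjection (fockCut A u N P) :=
  ⟨by rw [IsIdempotentElem, fockCut_mul_fockCut hu]; simp, star_fockCut hu P⟩

theorem fockLeft_mul_fockCut (hu : IsBasis A u) (P : ℕ → Prop) (a : A) :
    fockLeft u N a * fockCut A u N P = fockCut A u N P * fockLeft u N a := by
  ext w w'
  rw [fockCut_mul_apply hu, mul_fockCut_apply hu, fockLeft_mul hu, fockLeft_mul hu, mul_one,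
    one_mul, fockLeft_apply]
  rcases eq_or_ne w.1.length w'.1.length with h | h
  · rw [h]
  · simp [amp_eq_zero u h]

theorem fockCut_mul_fockCreate_mul_fockCut (hu : IsBasis A u) {P Q : ℕ → Prop} (h : ∀ k, P k → Q (k + 1)) (x : X) :
    fockCut A u N Q * (fockCreate u N x * fockCut A u N P) =
      fockCreate u N x * fockCut A u N P := by
  ext w w'
  rw [fockCut_mul_apply hu, ← mul_assoc, fockLeft_mul_fockCreate hu, one_smul, mul_fockCut_apply hu,
    fockCreate_mul_fockLeft hu, fockCreate_apply]
  rcases eq_or_ne w.1.length (w'.1.length + 1) with e | e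
  · rw [e]; split_ifs with h1 h2 h3 <;> first | rfl | (exact absurd (h _ ‹_›) ‹_›)
  · simp [creation_eq_zero u e]

theorem fockCut_mul_star_fockCreate_mul_fockCut (hu : IsBasis A u) {P Q : ℕ → Prop} (h : ∀ k, P (k + 1) → Q k)
    (x : X) : fockCut A u N Q * (star (fockCreate u N x) * fockCut A u N P) =
      star (fockCreate u N x) * fockCut A u N P := by
  have e1 : fockLeft u N (1 : A) * star (fockCreate u N x) = star (fockCreate u N x) := by
    rw [← star_one, ← star_fockLeft, ← star_mul, fockCreate_mul_fockLeft hu]; simp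
  have e2 : star (fockCreate u N x) * fockLeft u N (1 : A) = star (fockCreate u N x) := by
    rw [← star_one, ← star_fockLeft, ← star_mul, fockLeft_mul_fockCreate hu]; simp
  ext w w'
  rw [fockCut_mul_apply hu, ← mul_assoc, e1, mul_fockCut_apply hu, e2, CStarMatrix.star_apply,
    fockCreate_apply]
  rcases eq_or_ne w'.1.length (w.1.length + 1) with e | e
  · rw [e]; split_ifs with h1 h2 h3 <;> first | rfl | (exact absurd (h _ ‹_›) ‹_›)
  · simp [creation_eq_zero u e]

/-- The creation operators vanish on the top degree `N`, and this is the only degree where the inner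
product relation can fail. -/
theorem star_fockCreate_mul_fockCreate (hu : IsBasis A u) (x y : X) :
    star (fockCreate u N x) * fockCreate u N y =
      fockLeft u N (inn x y : A) * fockCut A u N (· < N) := by
  ext w w'
  rw [mul_fockCut_apply hu, fockLeft_mul hu, mul_one, FockMatrix.mul_apply]
  simp only [CStarMatrix.star_apply, fockCreate_apply, fockLeft_apply]
  rw [Finset.sum_coe_sort (wordsUpTo n N) fun v => star (creation (A := A) u v w x) *
    creation u v w' y]
  split_ifs with h
  · exact sum_star_creation_mul_creation hu h x y
  · refine Finset.sum_eq_zero fun v hv => ?_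
    rw [creation_eq_zero (w := v) (w' := w'.1) u, mul_zero]
    have := mem_wordsUpTo.1 hv
    omega

/-- Creation operators reach everything except degree `0`, the only place where the support relation
can fail. -/
theorem sum_fockCreate_mul_star (hu : IsBasis A u) {m : ℕ} {x : Fin m → X} (hx : IsBasis A x) :
    ∑ k, fockCreate u N (x k) * star (fockCreate u N (x k)) = fockCut A u N (0 < ·) := by
  ext w w'
  have : (∑ k, fockCreate u N (x k) * star (fockCreate u N (x k)) : FockMatrix A n N) w w' =
      ∑ k, ∑ v : wordsUpTo n N, creation u w v (x k) * star (creation (A := A) u w' v (x k)) := by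
    rw [show (∑ k, fockCreate u N (x k) * star (fockCreate u N (x k)) : FockMatrix A n N) w w' =
      ∑ k, (fockCreate u N (x k) * star (fockCreate u N (x k)) : FockMatrix A n N) w w' by
        erw [Finset.sum_apply, Finset.sum_apply]]
    refine Finset.sum_congr rfl fun k _ => ?_
    rw [FockMatrix.mul_apply]; rfl
  rw [this, fockCut_apply]
  rcases eq_or_ne w'.1 [] with h0 | h0
  · rw [h0]
    rw [Finset.sum_eq_zero fun k _ => Finset.sum_eq_zero fun v _ => by simp]
    split_ifs with h
    · rw [amp_eq_zero u (by simpa using h.ne')]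
    · rfl
  · refine (Finset.sum_congr rfl fun k _ => Finset.sum_coe_sort (wordsUpTo n N) fun v =>
      creation (A := A) u w v (x k) * star (creation (A := A) u w' v (x k))).trans ?_
    rw [sum_creation_mul_star_creation hu hx (length_le_of_wordsUpTo w) h0]
    split_ifs with h
    · rfl
    · exact amp_eq_zero u (by have := List.length_pos_iff.2 h0; omega) _

theorem norm_fockLeft_le (hu : IsBasis A u) (a : A) : ‖fockLeft u N a‖ ≤ ‖a‖ := by
  let ρ : A →⋆ₙₐ[ℂ] FockMatrix A n N :=
    { toFun := fockLeft u N
      map_smul' := map_smul _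
      map_zero' := map_zero _
      map_add' := map_add _
      map_mul' a b := (fockLeft_mul hu a b).symm
      map_star' a := (star_fockLeft u N a).symm }
  exact NonUnitalStarAlgHom.norm_apply_le ρ a

/-- Cutting by degree commutes with the left action, so this is a `⋆`-homomorphism in `a`. It is
injective already on the degree `m` block, hence isometric. -/
theorem norm_fockLeft_mul_fockCut (hu : IsBasis A u) {m : ℕ} (hm : m ≤ N) {P : ℕ → Prop} (hP : P m) (a : A) :
    ‖fockLeft u N a * fockCut A u N P‖ = ‖a‖ := by
  let ρ : A →⋆ₙₐ[ℂ] FockMatrix A n N :=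
    { toFun a := fockLeft u N a * fockCut A u N P
      map_smul' c a := by simp
      map_zero' := by simp
      map_add' a b := by simp [add_mul]
      map_mul' a b := by
        have e : fockCut A u N P * fockCut A u N P = fockCut A u N P :=
          (isStarProjection_fockCut hu P).1
        rw [← fockLeft_mul hu, mul_assoc, fockLeft_mul_fockCut hu P b, mul_assoc,
          ← mul_assoc (fockCut A u N P) (fockCut A u N P), e]
      map_star' a := by
        rw [star_mul, star_fockCut hu, star_fockLeft, fockLeft_mul_fockCut hu] }
  refine NonUnitalStarAlgHom.norm_map ρ ((injective_iff_map_eq_zero ρ).2 fun a ha => ?_) a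
  refine eq_zero_of_amp_eq_zero hu m fun w w' hw hw' => ?_
  have := congrFun (congrFun ha ⟨w, mem_wordsUpTo.2 (hw.trans_le hm)⟩)
    ⟨w', mem_wordsUpTo.2 (hw'.trans_le hm)⟩
  change (fockLeft u N a * fockCut A u N P) _ _ = 0 at this
  rwa [mul_fockCut_apply hu, if_pos (by rwa [hw']), fockLeft_mul hu, mul_one] at this

theorem norm_fockCreate_le (hu : IsBasis A u) (x : X) : ‖(fockCreate u N x : FockMatrix A n N)‖ ≤ ‖x‖ := by
  have h : ‖(fockCreate u N x : FockMatrix A n N)‖ ^ 2 ≤ ‖x‖ ^ 2 := by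
    rw [norm_sq_eq (A := A) x, sq, ← CStarRing.norm_star_mul_self,
      star_fockCreate_mul_fockCreate hu]
    calc _ ≤ ‖fockLeft u N (inn x x : A)‖ * ‖fockCut A u N (· < N)‖ := norm_mul_le _ _
      _ ≤ ‖(inn x x : A)‖ * 1 := by
        gcongr
        · exact norm_fockLeft_le hu _
        · exact IsStarProjection.norm_le _ (isStarProjection_fockCut hu _)
      _ = _ := mul_one _
  exact (pow_le_pow_iff_left₀ (norm_nonneg _) (norm_nonneg _) two_ne_zero).1 h

end Fock

end HilbertBimodule

/-! ### Sequences of truncated Fock modules and limits of middle-degree functionals. -/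

theorem isClosed_setOf_apply_star_mul_self_eq_zero {B : Type*} [CStarAlgebra B]
    (φ : StrongDual ℂ B) (R : B) : IsClosed {b : B | φ (star (R * b) * (R * b)) = 0} :=
  isClosed_eq (by fun_prop) continuous_const

theorem StarSubalgebra.coe_sum_mul_star {B ι : Type*} [Fintype ι] [CStarAlgebra B]
    (T : StarSubalgebra ℂ B) (f : ι → T) :
    ((∑ k, f k * star (f k) : T) : B) = ∑ k, (f k : B) * star (f k : B) :=
  map_sum T.subtype (fun k => f k * star (f k)) Finset.univ

namespace HilbertBimodule

variable {A : Type u} {X : Type v} [CStarAlgebra A] [NormedAddCommGroup X]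
    [NormedSpace ℂ X] [Module A X] [Module Aᵐᵒᵖ X] [HilbertBimodule A X]

section FockProd

variable [PartialOrder A] [StarOrderedRing A]

instance [Nontrivial A] (n N : ℕ) : Nontrivial (FockMatrix A n N) :=
  have : Nonempty (wordsUpTo n N) := ⟨[], mem_wordsUpTo.2 (Nat.zero_le _)⟩
  inferInstance

variable (A) in
/-- Bounded sequences of operators on the truncated Fock modules of length `0, 2, 4, …`. -/
abbrev FockProd (n : ℕ) : Type (max u v) :=
  lp (fun i : ULift.{v} ℕ => FockMatrix A n (2 * i.down)) ∞

noncomputable instance [Nontrivial A] (n : ℕ) : CStarAlgebra (FockProd.{u, v} A n) where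

variable [IsScalarTower ℂ A X] [SMulCommClass A Aᵐᵒᵖ X] {n : ℕ} {u : Fin n → X}

/-- The left action of `A` on the sequence of truncated Fock modules. -/
noncomputable def fockProdLeft [Nontrivial A] (hu : IsBasis A u) :
    A →⋆ₙₐ[ℂ] FockProd.{u, v} A n where
  toFun a := ⟨fun i => fockLeft u _ a, memℓp_infty ⟨‖a‖, by
    rintro _ ⟨i, rfl⟩; exact norm_fockLeft_le hu a⟩⟩
  map_smul' c a := Subtype.ext (funext fun _ => LinearMap.map_smul _ c a)
  map_zero' := Subtype.ext (funext fun _ => LinearMap.map_zero _)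
  map_add' a b := Subtype.ext (funext fun _ => LinearMap.map_add _ a b)
  map_mul' a b := Subtype.ext (funext fun _ => (fockLeft_mul hu a b).symm)
  map_star' a := Subtype.ext (funext fun _ => (star_fockLeft u _ a).symm)

/-- The creation operators on the sequence of truncated Fock modules. -/
noncomputable def fockProdCreate (hu : IsBasis A u) : X →ₗ[ℂ] FockProd.{u, v} A n where
  toFun x := ⟨fun i => fockCreate u _ x, memℓp_infty ⟨‖x‖, by
    rintro _ ⟨i, rfl⟩; exact norm_fockCreate_le hu x⟩⟩
  map_smul' c a := Subtype.ext (funext fun _ => LinearMap.map_smul _ c a)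
  map_add' a b := Subtype.ext (funext fun _ => LinearMap.map_add _ a b)

variable (A u) in
/-- The projection to the degrees at distance at most `K` from the middle degree. -/
noncomputable def fockBand (K : ℕ) (i : ULift.{v} ℕ) : FockMatrix A n (2 * i.down) :=
  fockCut A u _ fun k => k ≤ i.down + K ∧ i.down ≤ k + K

variable (u) in
/-- Sequences of operators that shift the degrees by a bounded amount. -/
def IsBanded (b : FockProd.{u, v} A n) : Prop :=
  ∃ L, ∀ K i, fockBand A u (K + L) i * (b i * fockBand A u K i) = b i * fockBand A u K i

theorem fockBand_mul_fockBand (hu : IsBasis A u) {K L : ℕ} (h : K ≤ L) (i : ULift.{v} ℕ) :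
    fockBand A u L i * fockBand A u K i = fockBand A u K i := by
  rw [fockBand, fockBand, fockCut_mul_fockCut hu]
  congr 1
  ext k
  constructor
  · exact fun h => h.2
  · exact fun h => ⟨by omega, h⟩

variable [Nontrivial A]

theorem fockProdLeft_apply (hu : IsBasis A u) (a : A) (i : ULift.{v} ℕ) :
    (fockProdLeft hu a : FockProd.{u, v} A n) i = fockLeft u _ a := rfl

theorem fockProdCreate_apply (hu : IsBasis A u) (x : X) (i : ULift.{v} ℕ) :
    (fockProdCreate hu x : FockProd.{u, v} A n) i = fockCreate u _ x := rfl

theorem IsBanded.mul {b c : FockProd.{u, v} A n} (hb : IsBanded u b)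
    (hc : IsBanded u c) : IsBanded u (b * c) := by
  obtain ⟨L, hb⟩ := hb
  obtain ⟨M, hc⟩ := hc
  refine ⟨M + L, fun K i => ?_⟩
  have h : (b * c) i * fockBand A u K i =
      b i * fockBand A u (K + M) i * (c i * fockBand A u K i) := by
    rw [lp.infty_coeFn_mul, Pi.mul_apply, mul_assoc, mul_assoc, hc]
  rw [h, ← mul_assoc, ← add_assoc, hb]

theorem IsBanded.add (hu : IsBasis A u) {b c : FockProd.{u, v} A n} (hb : IsBanded u b)
    (hc : IsBanded u c) : IsBanded u (b + c) := by
  obtain ⟨L, hb⟩ := hb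
  obtain ⟨M, hc⟩ := hc
  refine ⟨L + M, fun K i => ?_⟩
  rw [lp.coeFn_add, Pi.add_apply, add_mul, mul_add]
  congr 1
  · rw [← hb K i, ← mul_assoc, fockBand_mul_fockBand hu (by omega)]
  · rw [← hc K i, ← mul_assoc, fockBand_mul_fockBand hu (by omega)]

theorem isBanded_algebraMap (hu : IsBasis A u) (c : ℂ) :
    IsBanded u (algebraMap ℂ (FockProd.{u, v} A n) c) := by
  refine ⟨0, fun K i => ?_⟩
  rw [Algebra.algebraMap_eq_smul_one, lp.coeFn_smul, Pi.smul_apply, lp.infty_coeFn_one,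
    Pi.one_apply, smul_mul_assoc, one_mul, mul_smul_comm, add_zero,
    fockBand_mul_fockBand hu le_rfl]

theorem isBanded_fockProdLeft (hu : IsBasis A u) (a : A) :
    IsBanded u (fockProdLeft hu a : FockProd.{u, v} A n) := by
  refine ⟨0, fun K i => ?_⟩
  rw [fockProdLeft_apply, add_zero, fockBand, fockLeft_mul_fockCut hu, ← mul_assoc,
    (isStarProjection_fockCut hu _).1]

theorem isBanded_fockProdCreate (hu : IsBasis A u) (x : X) :
    IsBanded u (fockProdCreate hu x : FockProd.{u, v} A n) :=
  ⟨1, fun K i => fockCut_mul_fockCreate_mul_fockCut hu (fun k hk => by omega) x⟩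

theorem isBanded_star_fockProdCreate (hu : IsBasis A u) (x : X) :
    IsBanded u (star (fockProdCreate hu x) : FockProd.{u, v} A n) :=
  ⟨1, fun K i => fockCut_mul_star_fockCreate_mul_fockCut hu (fun k hk => by omega) x⟩

/-- The ⋆-algebra generated by the left action and the creation operators. -/
noncomputable def fockToeplitz (hu : IsBasis A u) : StarSubalgebra ℂ (FockProd.{u, v} A n) :=
  StarAlgebra.adjoin ℂ (Set.range (fockProdCreate hu) ∪ Set.range (fockProdLeft hu))

/-- Generators and their adjoints move degrees by at most one, and finite sums and products keep the
shift bounded. The adjoint is carried along so that the induction passes through `star`. -/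
theorem isBanded_of_mem (hu : IsBasis A u) {b : FockProd.{u, v} A n} (hb : b ∈ fockToeplitz hu) :
    IsBanded u b ∧ IsBanded u (star b) := by
  induction hb using StarAlgebra.adjoin_induction with
  | mem b hb =>
    rcases hb with ⟨x, rfl⟩ | ⟨a, rfl⟩
    · exact ⟨isBanded_fockProdCreate hu x, isBanded_star_fockProdCreate hu x⟩
    · exact ⟨isBanded_fockProdLeft hu a, by rw [← map_star]; exact isBanded_fockProdLeft hu _⟩
  | algebraMap c =>
    exact ⟨isBanded_algebraMap hu c, by
      rw [← algebraMap_star_comm]; exact isBanded_algebraMap hu _⟩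
  | add b c _ _ hb hc => exact ⟨hb.1.add hu hc.1, by rw [star_add]; exact hb.2.add hu hc.2⟩
  | mul b c _ _ hb hc => exact ⟨hb.1.mul hc.1, by rw [star_mul]; exact hc.2.mul hb.2⟩
  | star b _ hb => exact ⟨hb.2, by rw [star_star]; exact hb.1⟩

variable (u) in
/-- Sequences of operators that eventually vanish on every bounded band around the middle
degree. -/
def IsEdge (R : FockProd.{u, v} A n) : Prop :=
  ∀ K i, K < i.down → R i * fockBand A u K i = 0

/-- A limit of states concentrated on the middle degrees: it vanishes on operators living on the
edges, but it detects a given element of `A`. -/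
theorem exists_middle_functional (hu : IsBasis A u) (a : A) :
    ∃ φ : StrongDual ℂ (FockProd.{u, v} A n),
      (∀ b, ∃ t : ℝ, 0 ≤ t ∧ φ (star b * b) = t) ∧
      (∀ R, IsEdge u R → ∀ b ∈ (fockToeplitz hu).topologicalClosure,
        φ (star (R * b) * (R * b)) = 0) ∧
      φ (star (fockProdLeft hu a) * fockProdLeft hu a) = ((‖a‖ ^ 2 : ℝ) : ℂ) := by
  -- Each `f i` detects the norm of the compression of `a` to the middle degree `i`; compressing its
  -- argument to that degree then gives the functionals `g i`.
  choose f hf1 hf2 hf3 using fun i : ULift.{v} ℕ =>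
    CStarAlgebra.exists_positive_dual (fockLeft u (2 * i.down) a * fockBand A u 0 i)
  have hband : ∀ i : ULift.{v} ℕ, IsStarProjection (fockBand A u 0 i) := fun i =>
    isStarProjection_fockCut hu _
  have hlin : ∀ i : ULift.{v} ℕ, ∃ g : StrongDual ℂ (FockProd.{u, v} A n), ‖g‖ ≤ 1 ∧
      ∀ b, g b = f i (fockBand A u 0 i * b i * fockBand A u 0 i) := fun i => by
    let g : FockProd.{u, v} A n →ₗ[ℂ] ℂ :=
      { toFun b := f i (fockBand A u 0 i * b i * fockBand A u 0 i)
        map_add' b c := by rw [lp.coeFn_add, Pi.add_apply, mul_add, add_mul, map_add]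
        map_smul' c b := by
          rw [lp.coeFn_smul, Pi.smul_apply, mul_smul_comm, smul_mul_assoc, map_smul]; rfl }
    have hg : ∀ b, ‖g b‖ ≤ 1 * ‖b‖ := fun b => by
      have hn := IsStarProjection.norm_le _ (hband i)
      calc ‖g b‖ ≤ 1 * ‖fockBand A u 0 i * b i * fockBand A u 0 i‖ := (f i).le_of_opNorm_le (hf1 i) _
        _ ≤ 1 * (‖fockBand A u 0 i‖ * ‖b i‖ * ‖fockBand A u 0 i‖) := by
          gcongr
          exact (norm_mul_le _ _).trans (by gcongr; exact norm_mul_le _ _)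
        _ ≤ 1 * (1 * ‖b‖ * 1) := by
          gcongr
          exact lp.norm_apply_le_norm ENNReal.top_ne_zero b i
        _ = 1 * ‖b‖ := by ring
    exact ⟨g.mkContinuous 1 hg, g.mkContinuous_norm_le zero_le_one hg, fun b => rfl⟩
  choose g hg1 hg2 using hlin
  have hg3 : ∀ i b, g i (star b * b) =
      f i (star (b i * fockBand A u 0 i) * (b i * fockBand A u 0 i)) := fun i b => by
    rw [hg2, lp.infty_coeFn_mul, Pi.mul_apply, lp.coeFn_star, Pi.star_apply, star_mul,
      (hband i).2]
    simp only [mul_assoc]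
  have : (Filter.comap (ULift.down : ULift.{v} ℕ → ℕ) Filter.atTop).NeBot :=
    Filter.NeBot.comap_of_surj inferInstance ULift.down_surjective
  obtain ⟨U, φ, hU, hUl, hφ⟩ := StrongDual.exists_limit
    (Filter.comap ULift.down Filter.atTop) g 1 hg1
  have hlarge : ∀ K : ℕ, ∀ᶠ i : ULift.{v} ℕ in U, K < i.down := fun K =>
    hUl (Filter.preimage_mem_comap (Filter.eventually_gt_atTop K))
  refine ⟨φ, fun b => ?_, fun R hR => ?_, ?_⟩
  · choose t ht0 ht using fun i => hf2 i (b i * fockBand A u 0 i)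
    have h1 : Filter.Tendsto (fun i => ((t i : ℝ) : ℂ)) U (nhds (φ (star b * b))) := by
      simpa only [hg3, ht] using hφ (star b * b)
    have h2 : Filter.Tendsto t U (nhds (φ (star b * b)).re) := by
      exact ((Complex.continuous_re.tendsto _).comp h1).congr fun _ => Complex.ofReal_re _
    refine ⟨_, ge_of_tendsto' h2 ht0, ?_⟩
    refine tendsto_nhds_unique h1 ?_
    exact (Complex.continuous_ofReal.tendsto _).comp h2
  · have hclosed : IsClosed {b : FockProd.{u, v} A n | φ (star (R * b) * (R * b)) = 0} :=
      isClosed_setOf_apply_star_mul_self_eq_zero φ R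
    refine fun b hb => closure_minimal (fun b hb => ?_) hclosed hb
    obtain ⟨L, hL⟩ := (isBanded_of_mem hu hb).1
    refine tendsto_nhds_unique (hφ _) (tendsto_const_nhds.congr' ?_)
    filter_upwards [hlarge L] with i hi
    have : (R * b) i * fockBand A u 0 i = 0 := by
      rw [lp.infty_coeFn_mul, Pi.mul_apply, mul_assoc, ← hL 0 i, ← mul_assoc, zero_add,
        hR L i hi, zero_mul]
    rw [hg3, this, mul_zero, map_zero]
  · refine tendsto_nhds_unique (hφ _) (tendsto_const_nhds.congr fun i => ?_)
    rw [hg3, fockProdLeft_apply, hf3, fockBand, norm_fockLeft_mul_fockCut hu (m := i.down)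
      (by omega) (by omega)]


theorem isEdge_fockProdLeft_one (hu : IsBasis A u) :
    IsEdge u (fockProdLeft hu 1 - 1 : FockProd.{u, v} A n) := by
  intro K i _
  rw [lp.coeFn_sub, Pi.sub_apply, sub_mul, lp.infty_coeFn_one, Pi.one_apply, one_mul,
    fockProdLeft_apply, sub_eq_zero, fockBand]
  exact fockLeft_one_mul_fockCut hu _

theorem isEdge_star_fockProdCreate_mul (hu : IsBasis A u) (x y : X) :
    IsEdge u (star (fockProdCreate hu x) * fockProdCreate hu y -
      fockProdLeft hu (inn x y) : FockProd.{u, v} A n) := by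
  intro K i hK
  rw [lp.coeFn_sub, Pi.sub_apply, sub_mul, lp.infty_coeFn_mul, Pi.mul_apply, lp.coeFn_star,
    Pi.star_apply, fockProdLeft_apply, fockProdCreate_apply, fockProdCreate_apply,
    star_fockCreate_mul_fockCreate hu, mul_assoc, fockBand, fockCut_mul_fockCut hu, sub_eq_zero]
  congr 2
  ext k
  constructor
  · exact fun h => h.2
  -- In the band `k ≤ i + K < 2i`, so the top degree is avoided.
  · exact fun h => ⟨by omega, h⟩

theorem isEdge_sum_fockProdCreate_mul_star (hu : IsBasis A u) {m : ℕ} {x : Fin m → X}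
    (hx : IsBasis A x) :
    IsEdge u (∑ k, fockProdCreate hu (x k) * star (fockProdCreate hu (x k)) -
      fockProdLeft hu 1 : FockProd.{u, v} A n) := by
  intro K i hK
  have h : (∑ k, fockProdCreate hu (x k) * star (fockProdCreate hu (x k)) :
      FockProd.{u, v} A n) i = ∑ k, fockCreate u _ (x k) * star (fockCreate u _ (x k)) := by
    rw [lp.coeFn_sum, Finset.sum_apply]
    rfl
  rw [lp.coeFn_sub, Pi.sub_apply, h, sum_fockCreate_mul_star hu hx, fockProdLeft_apply, sub_mul,
    sub_eq_zero, fockBand, fockCut_mul_fockCut hu, fockLeft_one_mul_fockCut hu]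
  congr 1
  ext k
  constructor
  · exact fun h => h.2
  -- In the band `i ≤ k + K` with `K < i`, so `k > 0`.
  · exact fun h => ⟨by omega, h⟩

theorem fockProdCreate_mul_fockProdLeft (hu : IsBasis A u) (x : X) (a : A) :
    (fockProdCreate hu x * fockProdLeft hu a : FockProd.{u, v} A n) =
      fockProdCreate hu (MulOpposite.op a • x) :=
  Subtype.ext (funext fun _ => fockCreate_mul_fockLeft hu x a)

theorem fockProdLeft_mul_fockProdCreate (hu : IsBasis A u) (x : X) (a : A) :
    (fockProdLeft hu a * fockProdCreate hu x : FockProd.{u, v} A n) = fockProdCreate hu (a • x) :=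
  Subtype.ext (funext fun _ => fockLeft_mul_fockCreate hu x a)

end FockProd

/-! ### Representations with support `1` and injectivity of the coefficient map. -/

/-- A functional on a C⋆-algebra containing copies of `A` and `X` whose GNS kernel contains the
relations of a representation with support `1` yields such a representation. -/
theorem exists_representation_of_functional {B : Type (max u v)} [CStarAlgebra B] (t : X →ₗ[ℂ] B)
    (ρ : A →⋆ₙₐ[ℂ] B) (T : StarSubalgebra ℂ B) (hT : IsClosed (T : Set B))
    (htT : ∀ x, t x ∈ T) (hρT : ∀ a, ρ a ∈ T) (φ : StrongDual ℂ B)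
    (hpos : ∀ b, ∃ s : ℝ, 0 ≤ s ∧ φ (star b * b) = s)
    (hr : ∀ x a, t x * ρ a = t (MulOpposite.op a • x)) (hl : ∀ x a, ρ a * t x = t (a • x))
    (h1 : ∀ b ∈ T, φ (star ((ρ 1 - 1) * b) * ((ρ 1 - 1) * b)) = 0)
    (hin : ∀ x y, ∀ b ∈ T, φ (star ((star (t x) * t y - ρ (inn x y)) * b) *
      ((star (t x) * t y - ρ (inn x y)) * b)) = 0)
    (hsup : ∀ (m : ℕ) (x : Fin m → X), IsBasis A x → ∀ b ∈ T,
      φ (star ((∑ k, t (x k) * star (t (x k)) - ρ 1) * b) *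
        ((∑ k, t (x k) * star (t (x k)) - ρ 1) * b)) = 0)
    {a : A} (ha : φ (star (ρ a) * ρ a) ≠ 0) :
    ∃ (D : Type (max u v)) (_ : CStarAlgebra D) (V : X →ₗ[ℂ] D) (ρ : A →⋆ₙₐ[ℂ] D),
      ρ a ≠ 0 ∧ ρ 1 = 1 ∧ (∀ x a, V (MulOpposite.op a • x) = V x * ρ a) ∧
      (∀ a x, V (a • x) = ρ a * V x) ∧ (∀ x y, star (V x) * V y = ρ (inn x y)) ∧
      ∀ (m : ℕ) (x : Fin m → X), IsBasis A x → ∑ k, V (x k) * star (V (x k)) = 1 := by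
  let t' : X →ₗ[ℂ] T := t.codRestrict T.toSubalgebra.toSubmodule htT
  let ρ' : A →⋆ₙₐ[ℂ] T :=
    { toFun a := ⟨ρ a, hρT a⟩
      map_smul' c a := Subtype.ext (map_smul _ c a)
      map_zero' := Subtype.ext (map_zero _)
      map_add' a b := Subtype.ext (map_add _ a b)
      map_mul' a b := Subtype.ext (map_mul _ a b)
      map_star' a := Subtype.ext (map_star _ a) }
  -- GNS is applied to the restriction of `φ` to `T`: the defects of the relations are null only
  -- against vectors coming from `T`.
  obtain ⟨D, _, π, hπ⟩ := CStarAlgebra.exists_gns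
    (φ.comp T.toSubalgebra.toSubmodule.subtypeL : StrongDual ℂ T) (fun b => hpos b)
  have hker : ∀ R : T, (∀ b ∈ T, φ (star (R.1 * b) * (R.1 * b)) = 0) → π R = 0 := fun R hR =>
    (hπ R).2 fun b => hR b.1 b.2
  have hπ1 : π (ρ' 1) = 1 := by
    rw [← sub_eq_zero, ← map_one π, ← map_sub]
    exact hker _ h1
  refine ⟨D, inferInstance, π.toAlgHom.toLinearMap ∘ₗ t', (π : T →⋆ₙₐ[ℂ] D).comp ρ',
    fun h0 => ha ?_, hπ1, fun x a => ?_, fun a x => ?_, fun x y => ?_, fun m x hx => ?_⟩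
  · have := (hπ (ρ' a)).1 h0 1
    rw [mul_one] at this
    exact this
  · change π (t' _) = π (t' x) * π (ρ' a)
    rw [← map_mul]
    exact congrArg π (Subtype.ext (hr x a).symm)
  · change π (t' _) = π (ρ' a) * π (t' x)
    rw [← map_mul]
    exact congrArg π (Subtype.ext (hl x a).symm)
  · change star (π (t' x)) * π (t' y) = π (ρ' (inn x y))
    rw [← sub_eq_zero, ← map_star, ← map_mul, ← map_sub]
    exact hker _ (hin x y)
  · change ∑ k, π (t' (x k)) * star (π (t' (x k))) = 1
    rw [← sub_eq_zero, ← hπ1]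
    simp_rw [← map_star, ← map_mul]
    rw [← map_sum, ← map_sub]
    refine hker _ ?_
    have e : (∑ k, t' (x k) * star (t' (x k)) - ρ' 1 : T).1 =
        ∑ k, t (x k) * star (t (x k)) - ρ 1 :=
      congrArg (· - ρ 1) (T.coe_sum_mul_star fun k => t' (x k))
    rw [e]
    exact hsup m x hx

/-- Apply GNS to the limiting middle-degree functional. The defects of all the relations are edge
sequences and disappear, while `a` keeps the value `‖a‖²`. The lifted index set in `FockProd` puts
the target in the universe demanded by `CovRep`. -/
theorem exists_representation [IsScalarTower ℂ A X] [SMulCommClass A Aᵐᵒᵖ X]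
    (h : FiniteProjective A X) {a : A} (ha : a ≠ 0) :
    ∃ (D : Type (max u v)) (_ : CStarAlgebra D) (V : X →ₗ[ℂ] D) (ρ : A →⋆ₙₐ[ℂ] D),
      ρ a ≠ 0 ∧ ρ 1 = 1 ∧ (∀ x a, V (MulOpposite.op a • x) = V x * ρ a) ∧
      (∀ a x, V (a • x) = ρ a * V x) ∧ (∀ x y, star (V x) * V y = ρ (inn x y)) ∧
      ∀ (m : ℕ) (x : Fin m → X), IsBasis A x → ∑ k, V (x k) * star (V (x k)) = 1 := by
  let := CStarAlgebra.spectralOrder A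
  have := CStarAlgebra.spectralOrderedRing A
  have : Nontrivial A := ⟨⟨a, 0, ha⟩⟩
  obtain ⟨n, u, hu⟩ := h
  obtain ⟨φ, hpos, hedge, hφa⟩ := exists_middle_functional.{u, v} hu a
  refine exists_representation_of_functional (fockProdCreate hu) (fockProdLeft hu)
    (fockToeplitz.{u, v} hu).topologicalClosure (StarSubalgebra.isClosed_topologicalClosure _)
    (fun x => StarSubalgebra.le_topologicalClosure _
      (StarAlgebra.subset_adjoin ℂ _ (.inl ⟨x, rfl⟩)))
    (fun a => StarSubalgebra.le_topologicalClosure _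
      (StarAlgebra.subset_adjoin ℂ _ (.inr ⟨a, rfl⟩)))
    φ hpos (fockProdCreate_mul_fockProdLeft hu) (fockProdLeft_mul_fockProdCreate hu)
    (hedge _ (isEdge_fockProdLeft_one hu))
    (fun x y => hedge _ (isEdge_star_fockProdCreate_mul hu x y))
    (fun m x hx => hedge _ (isEdge_sum_fockProdCreate_mul_star hu hx)) ?_
  rw [hφa]
  exact_mod_cast pow_ne_zero 2 (norm_ne_zero_iff.2 ha)

/-- Every nonzero element of the coefficient algebra survives in some representation. -/
theorem exists_covRep [IsScalarTower ℂ A X] [SMulCommClass A Aᵐᵒᵖ X]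
    (h : FiniteProjective A X) {a : A} (ha : a ≠ 0) : ∃ R : CovRep A X, R.rho a ≠ 0 := by
  obtain ⟨D, _, V, ρ, hρa, h1, hr, hl, hin, hsup⟩ := exists_representation h ha
  exact ⟨{
    D := D
    nontriv := ⟨⟨_, _, hρa⟩⟩
    V := V
    rho :=
      { toFun := ρ
        map_one' := h1
        map_mul' := map_mul ρ
        map_zero' := map_zero ρ
        map_add' := map_add ρ
        commutes' c := by
          rw [Algebra.algebraMap_eq_smul_one, map_smul, h1, Algebra.algebraMap_eq_smul_one]
        map_star' := map_star ρ }
    V_right := hr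
    V_left := hl
    V_inn := hin
    support_eq_one := hsup }, hρa⟩

theorem CuntzPimsner.coeff_injective [IsScalarTower ℂ A X] [SMulCommClass A Aᵐᵒᵖ X]
    (h : FiniteProjective A X) : Function.Injective (coeff A X) := by
  refine (injective_iff_map_eq_zero _).2 fun a ha => ?_
  by_contra h0
  obtain ⟨R, hR⟩ := exists_covRep h h0
  exact hR (by rw [← proj_coeff, ha, map_zero])

end HilbertBimodule

/-! ### The map `σ` and the right multiplications `r_k`. -/

namespace HilbertBimodule.CuntzPimsner

variable {A : Type u} {X : Type v} [CStarAlgebra A] [NormedAddCommGroup X]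
    [NormedSpace ℂ X] [Module A X] [Module Aᵐᵒᵖ X] [HilbertBimodule A X]
    {n : ℕ} {u : Fin n → X}

/-- Insert `1 = ∑ S_{u_i} S_{u_i}⋆` on the right. -/
theorem eq_of_forall_mul_S (hu : IsBasis A u) {T T' : CuntzPimsner A X}
    (h : ∀ z, T * S A z = T' * S A z) : T = T' := by
  rw [← mul_one T, ← mul_one T', ← support_eq_one hu, Finset.mul_sum, Finset.mul_sum]
  exact Finset.sum_congr rfl fun i _ => by rw [← mul_assoc, h, mul_assoc]

/-- Expand `z` in the basis and move the coefficients past `T`. By `eq_of_forall_mul_S` this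
relation determines `σ(T)`, so on the commutant of the coefficients `σ` is multiplicative and
independent of the basis. -/
theorem sigma_mul_S (hu : IsBasis A u) {T : CuntzPimsner A X}
    (hT : ∀ a, Commute (coeff A X a) T) (z : X) : sigma u T * S A z = S A z * T := by
  conv_rhs => rw [S_eq_sum hu z]
  rw [sigma, Finset.sum_mul, Finset.sum_mul]
  refine Finset.sum_congr rfl fun i _ => ?_
  rw [mul_assoc, S_inn, mul_assoc, mul_assoc, (hT _).eq]

theorem commute_coeff_sigma (hu : IsBasis A u) {T : CuntzPimsner A X}
    (hT : ∀ a, Commute (coeff A X a) T) (a : A) : Commute (coeff A X a) (sigma u T) :=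
  eq_of_forall_mul_S hu fun z => by
    rw [mul_assoc, sigma_mul_S hu hT, mul_assoc, ← S_left, sigma_mul_S hu hT, S_left, mul_assoc]

theorem sigma_mul (hu : IsBasis A u) {T T' : CuntzPimsner A X}
    (hT : ∀ a, Commute (coeff A X a) T) (hT' : ∀ a, Commute (coeff A X a) T') :
    sigma u (T * T') = sigma u T * sigma u T' :=
  eq_of_forall_mul_S hu fun z => by
    rw [sigma_mul_S hu fun a => (hT a).mul_right (hT' a), mul_assoc (sigma u T),
      sigma_mul_S hu hT', ← mul_assoc (sigma u T), sigma_mul_S hu hT, mul_assoc]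

theorem sigma_one (hu : IsBasis A u) : sigma u (1 : CuntzPimsner A X) = 1 := by
  simp only [sigma, mul_one]
  exact support_eq_one hu

theorem sigma_star (T : CuntzPimsner A X) : sigma u (star T) = star (sigma u T) := by
  simp only [sigma, star_sum, star_mul, star_star, mul_assoc]

theorem sigma_add (T T' : CuntzPimsner A X) : sigma u (T + T') = sigma u T + sigma u T' := by
  simp only [sigma, mul_add, add_mul, Finset.sum_add_distrib]

theorem sigma_smul (c : ℂ) (T : CuntzPimsner A X) : sigma u (c • T) = c • sigma u T := by
  simp only [sigma, mul_smul_comm, smul_mul_assoc, Finset.smul_sum]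

theorem sigma_zero : sigma u (0 : CuntzPimsner A X) = 0 := by
  simp [sigma]

theorem sigma_sum {ι : Type*} (s : Finset ι) (T : ι → CuntzPimsner A X) :
    sigma u (∑ i ∈ s, T i) = ∑ i ∈ s, sigma u (T i) :=
  map_sum (AddMonoidHom.mk' (sigma u) sigma_add) T s

theorem sigma_algebraMap (hu : IsBasis A u) (c : ℂ) :
    sigma u (algebraMap ℂ (CuntzPimsner A X) c) = algebraMap ℂ _ c := by
  rw [Algebra.algebraMap_eq_smul_one, sigma_smul, sigma_one hu]

theorem continuous_sigma : Continuous (sigma u : CuntzPimsner A X → CuntzPimsner A X) := by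
  unfold sigma
  fun_prop

/-- Right multiplication touches only the last tensor leg, and `σ` adds a leg in front. Uniqueness
of right multiplications then gives `r_succ` for every basis. -/
theorem isRightMul_sigma (hu : IsBasis A u) {k : ℕ} {a : A} {T : CuntzPimsner A X}
    (h : IsRightMul X k a T) : IsRightMul X (k + 1) a (sigma u T) := by
  refine ⟨Submodule.sum_mem _ fun i _ => S_mul_mul_star_mem _ h.1, fun x hx => ?_⟩
  rw [tensorPower] at hx
  induction hx using Submodule.mul_induction_on' with
  | mem_mul_mem s hs y hy =>
    obtain ⟨z, rfl⟩ := hs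
    rw [sigma]
    conv_rhs => rw [S_eq_sum hu z]
    rw [Finset.sum_mul, Finset.sum_mul, Finset.sum_mul]
    refine Finset.sum_congr rfl fun i _ => ?_
    calc S A (u i) * T * star (S A (u i)) * (S A z * y)
        = S A (u i) * (T * ((star (S A (u i)) * S A z) * y)) := by simp only [mul_assoc]
      _ = S A (u i) * (coeff A X (inn (u i) z) * y * coeff A X a) := by
          rw [S_inn, h.2 _ (coeff_mul_mem _ k hy)]
      _ = _ := by simp only [mul_assoc]
  | add y _ z _ hy hz => rw [mul_add, add_mul, hy, hz]

theorem r_zero {a : A} (ha : a ∈ Set.center A) (h : FiniteProjective A X) :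
    r X 0 a = coeff A X a := by
  refine (r_spec h ha 0).unique ⟨Submodule.subset_span ⟨_, ⟨a, rfl⟩, _, ⟨1, rfl⟩, ?_⟩, ?_⟩
  · exact (by simp : coeff A X a = coeff A X a * star (coeff A X 1))
  · rintro _ ⟨b, rfl⟩
    change coeff A X a * coeff A X b = coeff A X b * coeff A X a
    rw [← map_mul, ← map_mul, (Set.mem_center_iff.1 ha).comm b]

theorem r_succ {a : A} (ha : a ∈ Set.center A) (hu : IsBasis A u) (k : ℕ) :
    r X (k + 1) a = sigma u (r X k a) :=
  (r_spec ⟨n, u, hu⟩ ha (k + 1)).unique (isRightMul_sigma hu (r_spec ⟨n, u, hu⟩ ha k))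

theorem r_map_zero (hu : IsBasis A u) (k : ℕ) : r X k (0 : A) = 0 := by
  induction k with
  | zero => rw [r_zero Set.zero_mem_center ⟨n, u, hu⟩, map_zero]
  | succ k ih => rw [r_succ Set.zero_mem_center hu, ih, sigma_zero]

theorem commute_coeff_r {a : A} (ha : a ∈ Set.center A) (hu : IsBasis A u) (k : ℕ) (b : A) :
    Commute (coeff A X b) (r X k a) := by
  induction k generalizing b with
  | zero =>
    rw [r_zero ha ⟨n, u, hu⟩, commute_iff_eq, ← map_mul, ← map_mul,
      (Set.mem_center_iff.1 ha).comm b]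
  | succ k ih => rw [r_succ ha hu]; exact commute_coeff_sigma hu ih b

/-- Strip `σ` from both factors until one index is `0`; that factor is then a coefficient, which
commutes with every `r_l(b)`. -/
theorem r_commute {a b : A} (ha : a ∈ Set.center A) (hb : b ∈ Set.center A) (hu : IsBasis A u)
    (k l : ℕ) : Commute (r X k a) (r X l b) := by
  induction k generalizing l with
  | zero => rw [r_zero ha ⟨n, u, hu⟩]; exact commute_coeff_r hb hu l a
  | succ k ih =>
    cases l with
    | zero => rw [r_zero hb ⟨n, u, hu⟩]; exact (commute_coeff_r ha hu (k + 1) b).symm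
    | succ l =>
      rw [r_succ ha hu, r_succ hb hu, commute_iff_eq,
        ← sigma_mul hu (commute_coeff_r ha hu k) (commute_coeff_r hb hu l), (ih l).eq,
        sigma_mul hu (commute_coeff_r hb hu l) (commute_coeff_r ha hu k)]

theorem r_mul {a b : A} (ha : a ∈ Set.center A) (hb : b ∈ Set.center A) (hu : IsBasis A u)
    (k : ℕ) : r X k a * r X k b = r X k (a * b) := by
  have hab := Set.mul_mem_center ha hb
  induction k with
  | zero => rw [r_zero ha ⟨n, u, hu⟩, r_zero hb ⟨n, u, hu⟩, r_zero hab ⟨n, u, hu⟩, map_mul]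
  | succ k ih =>
    rw [r_succ ha hu, r_succ hb hu, r_succ hab hu, ← ih,
      sigma_mul hu (commute_coeff_r ha hu k) (commute_coeff_r hb hu k)]

theorem star_r {a : A} (ha : a ∈ Set.center A) (hu : IsBasis A u) (k : ℕ) :
    star (r X k a) = r X k (star a) := by
  have ha' := Set.star_mem_center ha
  induction k with
  | zero => rw [r_zero ha ⟨n, u, hu⟩, r_zero ha' ⟨n, u, hu⟩, map_star]
  | succ k ih => rw [r_succ ha hu, r_succ ha' hu, ← ih, sigma_star]

/-- From `S_z⋆ S_z = (z | z)` and the embedding of the coefficients in `𝒪_X`. -/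
theorem S_eq_zero_iff {z : X} [IsScalarTower ℂ A X] [SMulCommClass A Aᵐᵒᵖ X]
    (h : FiniteProjective A X) : S A z = 0 ↔ z = 0 := by
  refine ⟨fun hz => ?_, fun hz => by rw [hz, map_zero]⟩
  have h1 : coeff A X (inn z z) = 0 := by rw [← S_inn, hz, mul_zero]
  have h2 : (inn z z : A) = 0 := coeff_injective h (by rw [h1, map_zero])
  have h3 := norm_sq_eq (A := A) z
  rw [h2, norm_zero] at h3
  exact norm_eq_zero.1 (pow_eq_zero_iff two_ne_zero |>.1 h3)

end HilbertBimodule.CuntzPimsner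

/-! ### The projections `r_k(p_i)` and nonvanishing along admissible paths. -/

namespace CuntzKriegerBimodule

open HilbertBimodule CuntzPimsner

variable {d : ℕ} {A : Fin d → Type u} [∀ i, CStarAlgebra (A i)]

theorem p_mem_center (i : Fin d) : p A i ∈ Set.center (Π i, A i) := by
  rw [Semigroup.mem_center_iff]
  intro g
  ext j
  rcases eq_or_ne j i with rfl | h <;> simp [p, *]

theorem star_p (i : Fin d) : star (p A i) = p A i := by
  ext j
  rcases eq_or_ne j i with rfl | h <;> simp [p, *]

theorem p_mul_self (i : Fin d) : p A i * p A i = p A i := by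
  ext j
  rcases eq_or_ne j i with rfl | h <;> simp [p, *]

theorem p_mul_p {i j : Fin d} (h : i ≠ j) : p A i * p A j = 0 := by
  ext k
  rcases eq_or_ne k i with rfl | h' <;> simp [p, *]

theorem sum_p : ∑ i, p A i = 1 := Finset.univ_sum_single _

variable {X : Type v} [NormedAddCommGroup X] [NormedSpace ℂ X] [Module (Π i, A i) X]
  [Module (Π i, A i)ᵐᵒᵖ X] [HilbertBimodule (Π i, A i) X]

theorem star_r_p (h : FiniteProjective (Π i, A i) X) (k : ℕ) (i : Fin d) :
    star (r X k (p A i)) = r X k (p A i) := by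
  obtain ⟨n, u, hu⟩ := h
  rw [star_r (p_mem_center i) hu, star_p]

theorem r_p_mul_self (h : FiniteProjective (Π i, A i) X) (k : ℕ) (i : Fin d) :
    r X k (p A i) * r X k (p A i) = r X k (p A i) := by
  obtain ⟨n, u, hu⟩ := h
  rw [r_mul (p_mem_center i) (p_mem_center i) hu, p_mul_self]

theorem sum_r_p (h : FiniteProjective (Π i, A i) X) (k : ℕ) : ∑ i, r X k (p A i) = 1 := by
  induction k with
  | zero => simp_rw [r_zero (p_mem_center _) h]; rw [← map_sum, sum_p, map_one]
  | succ k ih =>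
    obtain ⟨n, u, hu⟩ := h
    simp_rw [r_succ (p_mem_center _) hu]
    rw [← sigma_sum, ih, sigma_one hu]

/-- For `k = 0` the product sends `S_z` to `S_{p_i z p_j} = 0`; the other cases follow by applying
`σ`. -/
theorem r_p_mul_r_succ_p (h : FiniteProjective (Π i, A i) X) (k : ℕ) {i j : Fin d}
    (hij : adjMatrix A X i j ≠ 1) : r X k (p A i) * r X (k + 1) (p A j) = 0 := by
  have hx : ∀ x : X, p A i • (MulOpposite.op (p A j) • x) = 0 := by
    by_contra! h
    exact hij (by simp [adjMatrix, h])
  obtain ⟨n, u, hu⟩ := h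
  induction k with
  | zero =>
    refine eq_of_forall_mul_S hu fun z => ?_
    rw [r_succ (p_mem_center j) hu, mul_assoc,
      sigma_mul_S hu (commute_coeff_r (p_mem_center j) hu 0), r_zero (p_mem_center _) ⟨n, u, hu⟩,
      r_zero (p_mem_center _) ⟨n, u, hu⟩, ← S_right, ← S_left, hx, map_zero, zero_mul]
  | succ k ih =>
    rw [r_succ (p_mem_center i) hu, r_succ (p_mem_center j) hu (k + 1),
      ← sigma_mul hu (commute_coeff_r (p_mem_center _) hu _)
        (commute_coeff_r (p_mem_center _) hu _), ih, sigma_zero]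

variable [SMulCommClass (Π i, A i) (Π i, A i)ᵐᵒᵖ X] [IsScalarTower ℂ (Π i, A i) X]

/-- If `p_i X p_j ≠ 0` then the action of the simple algebra `A_i` on it is faithful. -/
theorem exists_smul_ne_zero (hA : ∀ i, IsSimpleCStarAlgebra (A i))
    (h : FiniteProjective (Π i, A i) X) {i j : Fin d} (hij : adjMatrix A X i j = 1)
    {c : Π i, A i} (hc : p A i * c ≠ 0) :
    ∃ x : X, c • (p A i • (MulOpposite.op (p A j) • x)) ≠ 0 := by
  have hmul : ∀ a b : A i, (Pi.single i (a * b) : Π i, A i) = Pi.single i a * Pi.single i b :=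
    fun a b => Pi.single_mul _ _ _
  have hci : (Pi.single i (c i) : Π i, A i) = p A i * c := by
    ext k; rcases eq_or_ne k i with rfl | h' <;> simp [p, *]
  -- `J` is the annihilator of `p_i X p_j` in `A_i`. Right multiples stay in it because the left
  -- action preserves `p_i X p_j`.
  let J : TwoSidedIdeal (A i) := TwoSidedIdeal.mk'
    {b | ∀ x : X, (Pi.single i b : Π i, A i) • (p A i • (MulOpposite.op (p A j) • x)) = 0}
    (by simp)
    (fun {a b} ha hb x => by rw [Pi.single_add, add_smul, ha, hb, add_zero])
    (fun {a} ha x => by rw [Pi.single_neg, neg_smul, ha, neg_zero])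
    (fun {a b} hb x => by rw [hmul, mul_smul, hb, smul_zero])
    (fun {a b} ha x => by
      rw [hmul, mul_smul, ← mul_smul _ (p A i), ← ((p_mem_center i).comm _), mul_smul,
        smul_comm _ (MulOpposite.op (p A j))]
      exact ha _)
  have hJ : ∀ b, b ∈ J ↔
      ∀ x : X, (Pi.single i b : Π i, A i) • (p A i • (MulOpposite.op (p A j) • x)) = 0 := fun b =>
    TwoSidedIdeal.mem_mk' ..
  have hJc : IsClosed (J : Set (A i)) := by
    -- Closedness is checked inside `𝒪_X`, where the left action becomes a continuous product.
    have : (J : Set (A i)) = ⋂ x : X, {b | coeff (Π i, A i) X (Pi.single i b) *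
        S (Π i, A i) (p A i • (MulOpposite.op (p A j) • x)) = 0} := by
      ext b
      rw [SetLike.mem_coe, hJ, Set.mem_iInter]
      refine forall_congr' fun x => ?_
      rw [Set.mem_ofPred_eq, ← S_left, S_eq_zero_iff h]
    rw [this]
    refine isClosed_iInter fun x => isClosed_eq (Continuous.mul ?_ continuous_const)
      continuous_const
    have : Continuous (coeff (Π i, A i) X) :=
      AddMonoidHomClass.continuous_of_bound (coeff (Π i, A i) X) 1 fun a => by
        rw [one_mul]
        exact NonUnitalStarAlgHom.norm_apply_le (coeff (Π i, A i) X) a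
    exact this.comp (continuous_single i)
  rcases (hA i).2 J hJc with hJ' | hJ'
  · by_contra! hx
    have : c i ∈ J := (hJ _).2 fun x => by
      rw [hci, (p_mem_center i).comm, mul_smul, ← mul_smul (p A i), p_mul_self, hx]
    rw [hJ', TwoSidedIdeal.mem_bot] at this
    exact hc (by rw [← hci, this, Pi.single_zero])
  · have h1 : (1 : A i) ∈ J := by rw [hJ']; trivial
    exfalso
    obtain ⟨x, hx⟩ : ∃ x : X, p A i • (MulOpposite.op (p A j) • x) ≠ 0 := by
      by_contra h
      simp [adjMatrix, h] at hij
    refine hx ?_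
    rw [← p_mul_self, mul_smul]
    exact (hJ 1).1 h1 x

/-- Products of the projections `r_k(p_{x_k})` along a path of `adjMatrix` do not vanish: they fix
some vector `y`, which can be chosen off the kernel of a given `c` with `p_{x_0} c ≠ 0`. -/
theorem exists_r_p_mul_eq_self (hA : ∀ i, IsSimpleCStarAlgebra (A i))
    (h : FiniteProjective (Π i, A i) X) (N : ℕ) {x : ℕ → Fin d}
    (hx : ∀ k, adjMatrix A X (x k) (x (k + 1)) = 1) {c : Π i, A i} (hc : p A (x 0) * c ≠ 0) :
    ∃ y : CuntzPimsner (Π i, A i) X, coeff (Π i, A i) X c * y ≠ 0 ∧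
      ∀ k ≤ N, r X k (p A (x k)) * y = y := by
  induction N generalizing x c with
  | zero =>
    refine ⟨coeff _ X (p A (x 0)), ?_, fun k hk => ?_⟩
    · rw [← map_mul, ← (p_mem_center _).comm]
      exact fun h0 => hc (coeff_injective h (by rw [h0, map_zero]))
    · obtain rfl : k = 0 := by omega
      rw [r_zero (p_mem_center _) h, ← map_mul, p_mul_self]
  | succ N ih =>
    obtain ⟨z, hz⟩ := exists_smul_ne_zero hA h (hx 0) hc
    set w := p A (x 0) • (MulOpposite.op (p A (x 1)) • z) with hw
    have hwr : MulOpposite.op (p A (x 1)) • w = w := by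
      rw [hw, ← smul_comm, ← mul_smul (MulOpposite.op (p A (x 1))), ← MulOpposite.op_mul, p_mul_self]
    have hwl : p A (x 0) • w = w := by rw [hw, ← mul_smul, p_mul_self]
    -- The coefficient for the rest of the path is `(cw | cw) = S_{cw}⋆ S_{cw}`: if it does not kill
    -- `y`, then `c S_w y ≠ 0`. Its corner at `p_{x_1}` is nonzero because `w p_{x_1} = w`.
    have hinn : p A (x 1) * inn (c • w) (c • w) ≠ 0 := by
      rw [(p_mem_center _).comm, ← inn_op_smul_right, ← smul_comm c (MulOpposite.op _) w, hwr]
      intro h0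
      have h3 := norm_sq_eq (A := Π i, A i) (c • w)
      rw [h0, norm_zero] at h3
      exact hz (norm_eq_zero.1 (pow_eq_zero_iff two_ne_zero |>.1 h3))
    obtain ⟨y, hy, hry⟩ := ih (x := fun k => x (k + 1)) (fun k => hx (k + 1)) hinn
    refine ⟨S _ w * y, fun h0 => hy ?_, fun k hk => ?_⟩
    · rw [← S_inn, mul_assoc, S_left, mul_assoc, h0, mul_zero]
    · cases k with
      | zero => rw [r_zero (p_mem_center _) h, ← mul_assoc, ← S_left, hwl]
      | succ k =>
        obtain ⟨n, u, hu⟩ := h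
        rw [r_succ (p_mem_center _) hu, ← mul_assoc,
          sigma_mul_S hu (commute_coeff_r (p_mem_center _) hu k), mul_assoc, hry k (by omega)]

end CuntzKriegerBimodule

/-! ### Characters of a commutative algebra and their itineraries. -/

namespace CuntzKriegerBimodule

open HilbertBimodule WeakDual

section Itinerary

variable {d : ℕ} {M : Matrix (Fin d) (Fin d) ℕ}

instance : T2Space (MarkovSpace M) :=
  inferInstanceAs (T2Space {x : ℕ → Fin d // ∀ k, M (x k) (x (k + 1)) = 1})

variable {B : Type v} [CommCStarAlgebra B] {q : ℕ → Fin d → B}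

theorem character_eq_zero_or_one {e : B} (he : e * e = e) (χ : characterSpace ℂ B) :
    χ e = 0 ∨ χ e = 1 := by
  have h : χ e * χ e = χ e := by rw [← map_mul, he]
  exact (IsIdempotentElem.iff_eq_zero_or_one (p := χ e)).1 h

/-- If every character sent some factor to `0`, the Gelfand transform of the product would vanish,
and it is injective. -/
theorem exists_character_eq_one (hidem : ∀ k i, q k i * q k i = q k i) {x : ℕ → Fin d} {N : ℕ}
    (hne : ∏ k ∈ Finset.range N, q k (x k) ≠ 0) :
    ∃ χ : characterSpace ℂ B, ∀ k < N, χ (q k (x k)) = 1 := by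
  by_contra! hχ
  refine hne ((gelfandTransform_isometry B).injective ?_)
  rw [map_zero]
  ext χ
  obtain ⟨k, hk, hne⟩ := hχ χ
  rw [gelfandTransform_apply_apply, map_prod]
  exact Finset.prod_eq_zero (Finset.mem_range.2 hk)
    ((character_eq_zero_or_one (hidem _ _) χ).resolve_right hne)

/-- Projections `q k i` that form a partition of unity for each `k`, whose transitions follow the
matrix `M`, and which separate the characters, identify the character space with the
Markov space of `M` once all admissible finite products are nonzero. -/
theorem exists_homeomorph_characterSpace (hidem : ∀ k i, q k i * q k i = q k i)
    (horth : ∀ k i j, i ≠ j → q k i * q k j = 0) (hsum : ∀ k, ∑ i, q k i = 1)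
    (htrans : ∀ k i j, M i j ≠ 1 → q k i * q (k + 1) j = 0)
    (hgen : ∀ χ ψ : characterSpace ℂ B, (∀ k i, χ (q k i) = ψ (q k i)) → χ = ψ)
    (hne : ∀ x : MarkovSpace M, ∀ N, ∏ k ∈ Finset.range N, q k (x.1 k) ≠ 0) :
    ∃ h : MarkovSpace M ≃ₜ characterSpace ℂ B,
      ∀ x k i, h x (q k i) = if x.1 k = i then 1 else 0 := by
  have hex : ∀ (χ : characterSpace ℂ B) (k : ℕ), ∃ i, χ (q k i) = 1 := by
    intro χ k
    by_contra! h
    have h0 : ∑ i, χ (q k i) = 0 := Finset.sum_eq_zero fun i _ =>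
      (character_eq_zero_or_one (hidem k i) χ).resolve_right (h i)
    rw [← map_sum, hsum, map_one] at h0
    exact one_ne_zero h0
  choose f hf using hex
  have hval : ∀ χ k i, χ (q k i) = if f χ k = i then 1 else 0 := by
    intro χ k i
    split_ifs with h
    · rw [← h, hf]
    · have h0 : χ (q k (f χ k) * q k i) = 0 := by rw [horth k _ _ h, map_zero]
      rwa [map_mul, hf, one_mul] at h0
  have hpath : ∀ χ k, M (f χ k) (f χ (k + 1)) = 1 := by
    intro χ k
    by_contra h
    have h0 : χ (q k (f χ k) * q (k + 1) (f χ (k + 1))) = 0 := by rw [htrans k _ _ h, map_zero]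
    rw [map_mul, hf, hf, one_mul] at h0
    exact one_ne_zero h0
  let F : characterSpace ℂ B → MarkovSpace M := fun χ => ⟨f χ, hpath χ⟩
  have hev : ∀ b : B, Continuous fun χ : characterSpace ℂ B => χ b := fun b =>
    (WeakDual.eval_continuous b).comp continuous_subtype_val
  have hF : Continuous F := by
    refine Continuous.subtype_mk (continuous_pi fun k => continuous_discrete_rng.2 fun i => ?_) _
    have : (fun χ => f χ k) ⁻¹' {i} = {χ : characterSpace ℂ B | χ (q k i) ≠ 0} := by
      ext χ
      simp [hval]
    rw [this]
    exact isOpen_ne_fun (hev _) continuous_const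
  have hinj : Function.Injective F := fun χ ψ h => hgen χ ψ fun k i => by
    rw [hval, hval, show f χ = f ψ from congrArg Subtype.val h]
  have hsurj : Function.Surjective F := by
    intro x
    -- Characters following `x` for the first `N` steps form decreasing nonempty compact sets; a
    -- point in all of them has itinerary `x`.
    let C : ℕ → Set (characterSpace ℂ B) := fun N => {χ | ∀ k < N, χ (q k (x.1 k)) = 1}
    have hC : ∀ N, IsClosed (C N) := fun N => by
      simp only [C, Set.ofPred_forall]
      exact isClosed_iInter fun k => isClosed_iInter fun _ =>
        isClosed_eq (hev _) continuous_const
    obtain ⟨χ, hχ⟩ := IsCompact.nonempty_iInter_of_sequence_nonempty_isCompact_isClosed C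
      (fun N χ h k hk => h k (hk.trans (Nat.lt_succ_self N)))
      (fun N => exists_character_eq_one hidem (hne x N)) (hC 0).isCompact hC
    refine ⟨χ, Subtype.ext (funext fun k => ?_)⟩
    have h1 := Set.mem_iInter.1 hχ (k + 1) k (Nat.lt_succ_self k)
    rw [hval] at h1
    by_contra h
    rw [if_neg h] at h1
    exact zero_ne_one h1
  let e := Equiv.ofBijective F ⟨hinj, hsurj⟩
  -- The itinerary map is a continuous bijection from a compact space to a Hausdorff one.
  refine ⟨(Continuous.homeoOfEquivCompactToT2 (f := e) hF).symm, fun x k i => ?_⟩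
  have hx : F (e.symm x) = x := e.apply_symm_apply x
  change e.symm x (q k i) = _
  rw [hval, show f (e.symm x) = x.1 from congrArg Subtype.val hx]

end Itinerary

theorem character_ext_topologicalClosure_adjoin {C : Type v} [CStarAlgebra C] {s : Set C}
    {χ ψ : characterSpace ℂ (StarAlgebra.adjoin ℂ s).topologicalClosure}
    (h : ∀ T (hT : T ∈ s),
      χ ⟨T, StarSubalgebra.le_topologicalClosure _ (StarAlgebra.subset_adjoin ℂ s hT)⟩ =
        ψ ⟨T, StarSubalgebra.le_topologicalClosure _ (StarAlgebra.subset_adjoin ℂ s hT)⟩) :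
    χ = ψ := by
  have : IsClosed ((StarAlgebra.adjoin ℂ s).topologicalClosure : Set C) :=
    StarSubalgebra.isClosed_topologicalClosure _
  refine StarAlgHomClass.ext_topologicalClosure (R := ℂ) (map_continuous χ) (map_continuous ψ)
    fun T => ?_
  induction T using StarAlgebra.adjoin_induction_subtype with
  | mem T hT => exact h T hT
  | algebraMap c => rw [AlgHomClass.commutes, AlgHomClass.commutes, AlgHomClass.commutes]
  | add T T' hT hT' => rw [map_add, map_add, map_add, hT, hT']
  | mul T T' hT hT' => rw [map_mul, map_mul, map_mul, hT, hT']
  | star T hT => rw [map_star, map_star, map_star, hT]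

/-! ### The diagonal algebra `𝒟_A`, its characters and the shift. -/

section Diagonal

variable {d : ℕ} {A : Fin d → Type u} [∀ i, CStarAlgebra (A i)]
    {X : Type v} [NormedAddCommGroup X] [NormedSpace ℂ X]
    [Module (Π i, A i) X] [Module (Π i, A i)ᵐᵒᵖ X] [HilbertBimodule (Π i, A i) X]

open CuntzPimsner

theorem isClosed_diagonal : IsClosed (diagonal A X : Set (CuntzPimsner (Π i, A i) X)) :=
  StarSubalgebra.isClosed_topologicalClosure _

theorem r_mem_diagonal (k : ℕ) (i : Fin d) : r X k (p A i) ∈ diagonal A X :=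
  StarSubalgebra.le_topologicalClosure _ (StarAlgebra.subset_adjoin ℂ _ ⟨k, i, rfl⟩)

theorem diagonal_le {E : StarSubalgebra ℂ (CuntzPimsner (Π i, A i) X)}
    (hE : IsClosed (E : Set (CuntzPimsner (Π i, A i) X)))
    (h : ∀ k i, r X k (p A i) ∈ E) : diagonal A X ≤ E := by
  refine StarSubalgebra.topologicalClosure_minimal (StarAlgebra.adjoin_le ?_) hE
  rintro _ ⟨k, i, rfl⟩
  exact h k i

theorem commute_coeff_of_mem_diagonal (h : FiniteProjective (Π i, A i) X)
    {T : CuntzPimsner (Π i, A i) X} (hT : T ∈ diagonal A X) (a : Π i, A i) :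
    Commute (coeff _ X a) T := by
  obtain ⟨n, u, hu⟩ := h
  refine ((StarSubalgebra.mem_centralizer_iff ℂ).1 (diagonal_le
    (E := StarSubalgebra.centralizer ℂ (Set.range (coeff (Π i, A i) X)))
    (Set.isClosed_centralizer _) (fun k i => ?_) hT) _ ⟨a, rfl⟩).1
  rw [StarSubalgebra.mem_centralizer_iff]
  rintro _ ⟨b, rfl⟩
  rw [← map_star]
  exact ⟨commute_coeff_r (p_mem_center i) hu k b, commute_coeff_r (p_mem_center i) hu k _⟩

/-- Centralizers are closed, so commutation passes from generators to `𝒟_A` one side at a time: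
first a generator against all of `𝒟_A`, then all against all. -/
theorem diagonal_mul_comm (h : FiniteProjective (Π i, A i) X) {T T' : CuntzPimsner (Π i, A i) X}
    (hT : T ∈ diagonal A X) (hT' : T' ∈ diagonal A X) : T * T' = T' * T := by
  have hr : ∀ k i, ∀ W ∈ diagonal A X, r X k (p A i) * W = W * r X k (p A i) := by
    intro k i W hW
    refine ((StarSubalgebra.mem_centralizer_iff ℂ).1 (diagonal_le
      (E := StarSubalgebra.centralizer ℂ {r X k (p A i)})
      (Set.isClosed_centralizer _) (fun l j => ?_) hW) _ rfl).1
    rw [StarSubalgebra.mem_centralizer_iff]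
    rintro _ rfl
    rw [star_r_p h]
    obtain ⟨n, u, hu⟩ := h
    exact ⟨r_commute (p_mem_center i) (p_mem_center j) hu k l,
      r_commute (p_mem_center i) (p_mem_center j) hu k l⟩
  refine ((StarSubalgebra.mem_centralizer_iff ℂ).1 (diagonal_le
    (E := StarSubalgebra.centralizer ℂ (diagonal A X))
    (Set.isClosed_centralizer _) (fun l j => ?_) hT') _ hT).1
  rw [StarSubalgebra.mem_centralizer_iff]
  exact fun W hW => ⟨(hr l j W hW).symm, (hr l j _ (star_mem hW)).symm⟩

variable {n : ℕ} {u : Fin n → X}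

theorem sigma_mem_diagonal (hu : IsBasis (Π i, A i) u) {T : CuntzPimsner (Π i, A i) X}
    (hT : T ∈ diagonal A X) : sigma u T ∈ diagonal A X := by
  -- The commutation clause is what makes `σ` multiplicative on `E`, so that `E` is closed under
  -- products.
  let E : StarSubalgebra ℂ (CuntzPimsner (Π i, A i) X) :=
    { carrier := {T | (∀ a, Commute (coeff _ X a) T) ∧ sigma u T ∈ diagonal A X}
      mul_mem' := fun hT hT' => ⟨fun a => (hT.1 a).mul_right (hT'.1 a), by
        rw [sigma_mul hu hT.1 hT'.1]; exact mul_mem hT.2 hT'.2⟩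
      add_mem' := fun hT hT' => ⟨fun a => (hT.1 a).add_right (hT'.1 a), by
        rw [sigma_add]; exact add_mem hT.2 hT'.2⟩
      algebraMap_mem' := fun c => ⟨fun a => Algebra.commute_algebraMap_right c _, by
        rw [sigma_algebraMap hu]; exact algebraMap_mem _ c⟩
      star_mem' := fun hT => ⟨fun a => by
        have := (hT.1 (star a)).star_star
        rwa [← map_star, star_star] at this, by
        rw [sigma_star]; exact star_mem hT.2⟩ }
  have hE : IsClosed (E : Set (CuntzPimsner (Π i, A i) X)) := by
    have hc : IsClosed {T : CuntzPimsner (Π i, A i) X | ∀ a, Commute (coeff _ X a) T} := by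
      simp only [Set.ofPred_forall]
      exact isClosed_iInter fun a => isClosed_eq (by fun_prop) (by fun_prop)
    exact hc.inter ((isClosed_diagonal (A := A) (X := X)).preimage
      (continuous_sigma (u := u)))
  refine (diagonal_le hE (fun k i => ⟨fun a => commute_coeff_r (p_mem_center i) hu k a, ?_⟩) hT).2
  rw [← r_succ (p_mem_center i) hu]
  exact r_mem_diagonal _ _

/-- The endomorphism of `𝒟_A` given by `σ`. -/
noncomputable def sigmaDiagonal (hu : IsBasis (Π i, A i) u) : diagonal A X →⋆ₐ[ℂ] diagonal A X where
  toFun T := ⟨sigma u T, sigma_mem_diagonal hu T.2⟩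
  map_one' := Subtype.ext (sigma_one hu)
  map_mul' T T' := Subtype.ext (sigma_mul hu
    (commute_coeff_of_mem_diagonal ⟨n, u, hu⟩ T.2) (commute_coeff_of_mem_diagonal ⟨n, u, hu⟩ T'.2))
  map_zero' := Subtype.ext sigma_zero
  map_add' _ _ := Subtype.ext (sigma_add _ _)
  commutes' c := Subtype.ext (sigma_algebraMap hu c)
  map_star' _ := Subtype.ext (sigma_star _)

theorem character_diagonal_ext {χ ψ : characterSpace ℂ (diagonal A X)}
    (h : ∀ k i, χ ⟨_, r_mem_diagonal k i⟩ = ψ ⟨_, r_mem_diagonal k i⟩) : χ = ψ := by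
  refine character_ext_topologicalClosure_adjoin ?_
  rintro _ ⟨k, i, rfl⟩
  exact h k i

/-- Composing the character of `x` with `σ` gives a character whose value on `r_k(p_i)` is the old
value on `r_{k+1}(p_i)`. Its itinerary is the shift of `x`, and itineraries determine characters. -/
theorem homeomorph_sigma {e : MarkovSpace (adjMatrix A X) ≃ₜ characterSpace ℂ (diagonal A X)}
    (he : ∀ x k i, e x ⟨_, r_mem_diagonal k i⟩ = if x.1 k = i then 1 else 0)
    (hu : IsBasis (Π i, A i) u) (x : MarkovSpace (adjMatrix A X)) (T : diagonal A X) :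
    e x ⟨_, sigma_mem_diagonal hu T.2⟩ = e x.shift T := by
  have := isClosed_diagonal (A := A) (X := X)
  have hshift : CharacterSpace.compContinuousMap (sigmaDiagonal hu) (e x) = e x.shift :=
    character_diagonal_ext fun k i => by
      rw [he]
      refine Eq.trans ?_ (he x (k + 1) i)
      exact congrArg (e x) (Subtype.ext (r_succ (p_mem_center i) hu k).symm)
  exact DFunLike.congr_fun hshift T

variable [SMulCommClass (Π i, A i) (Π i, A i)ᵐᵒᵖ X] [IsScalarTower ℂ (Π i, A i) X]

theorem exists_homeomorph_characterSpace_diagonal (hA : ∀ i, IsSimpleCStarAlgebra (A i))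
    (h : FiniteProjective (Π i, A i) X) :
    ∃ e : MarkovSpace (adjMatrix A X) ≃ₜ characterSpace ℂ (diagonal A X),
      ∀ x k i, e x ⟨_, r_mem_diagonal k i⟩ = if x.1 k = i then 1 else 0 := by
  have := isClosed_diagonal (A := A) (X := X)
  let : CommCStarAlgebra (diagonal A X) :=
    { StarSubalgebra.cstarAlgebra (diagonal A X) with
      mul_comm := fun T T' => Subtype.ext (diagonal_mul_comm h T.2 T'.2) }
  refine exists_homeomorph_characterSpace (B := diagonal A X)
    (q := fun k i => ⟨_, r_mem_diagonal k i⟩) (fun k i => Subtype.ext (r_p_mul_self h k i))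
    (fun k i j hij => Subtype.ext ?_) (fun k => Subtype.ext ?_)
    (fun k i j hij => Subtype.ext (r_p_mul_r_succ_p h k hij))
    (fun χ ψ hχ => character_diagonal_ext hχ) (fun x N h0 => ?_)
  · obtain ⟨n, u, hu⟩ := h
    change r X k (p A i) * r X k (p A j) = 0
    rw [r_mul (p_mem_center i) (p_mem_center j) hu, p_mul_p hij, r_map_zero hu]
  · rw [AddSubmonoidClass.coe_finsetSum]
    exact sum_r_p h k
  · have hne : p A (x.1 0) * 1 ≠ 0 := by
      have := (hA (x.1 0)).1
      rw [mul_one, p, Ne, Pi.single_eq_zero_iff]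
      exact one_ne_zero
    -- With `c = 1` this gives a nonzero `y` fixed by every factor, hence by the whole product,
    -- which therefore cannot vanish.
    obtain ⟨y, hy, hxy⟩ := exists_r_p_mul_eq_self hA h N x.2 hne
    rw [map_one, one_mul] at hy
    refine hy ?_
    have hprod : ∀ K ≤ N, ((∏ k ∈ Finset.range K,
        (⟨_, r_mem_diagonal k (x.1 k)⟩ : diagonal A X) : diagonal A X) :
          CuntzPimsner (Π i, A i) X) * y = y := by
      intro K hK
      induction K with
      | zero => exact one_mul y
      | succ K ih =>
        rw [Finset.prod_range_succ]
        refine (mul_assoc _ _ y).trans ?_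
        rw [hxy K (by omega)]
        exact ih (by omega)
    rw [← hprod N le_rfl, h0]
    exact zero_mul y

end Diagonal

end CuntzKriegerBimodule

theorem proposition5p6 {d : ℕ} (hd : 1 < d) (A : Fin d → Type u) [∀ i, CStarAlgebra (A i)]
    (hA : ∀ i, IsSimpleCStarAlgebra (A i))
    (X : Type v) [NormedAddCommGroup X] [NormedSpace ℂ X] [CompleteSpace X]
    [Module (Π i, A i) X] [Module (Π i, A i)ᵐᵒᵖ X] [SMulCommClass (Π i, A i) (Π i, A i)ᵐᵒᵖ X]
    [IsScalarTower ℂ (Π i, A i) X] [IsScalarTower ℂ (Π i, A i)ᵐᵒᵖ X]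
    [HilbertBimodule (Π i, A i) X]
    (hfull : HilbertBimodule.Full (Π i, A i) X)
    (hfp : HilbertBimodule.FiniteProjective (Π i, A i) X) :
    (∀ T ∈ CuntzKriegerBimodule.diagonal A X, ∀ T' ∈ CuntzKriegerBimodule.diagonal A X,
      T * T' = T' * T) ∧
    CompactSpace (CuntzKriegerBimodule.MarkovSpace (CuntzKriegerBimodule.adjMatrix A X)) ∧
    ∃ h : CuntzKriegerBimodule.MarkovSpace (CuntzKriegerBimodule.adjMatrix A X) ≃ₜ
        WeakDual.characterSpace ℂ (CuntzKriegerBimodule.diagonal A X),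
      (∀ i, ∃ hp : HilbertBimodule.CuntzPimsner.coeff (Π i, A i) X (CuntzKriegerBimodule.p A i) ∈
          CuntzKriegerBimodule.diagonal A X,
        ∀ x, h x ⟨_, hp⟩ = Set.indicator (CuntzKriegerBimodule.MarkovSpace.cylinder
          (CuntzKriegerBimodule.adjMatrix A X) i) (fun _ => (1 : ℂ)) x) ∧
      ∀ (n : ℕ) (u : Fin n → X), HilbertBimodule.IsBasis (Π i, A i) u →
        ∀ T : CuntzKriegerBimodule.diagonal A X,
          ∃ hT : HilbertBimodule.CuntzPimsner.sigma u
              (T : HilbertBimodule.CuntzPimsner (Π i, A i) X) ∈ CuntzKriegerBimodule.diagonal A X,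
            ∀ x, h x ⟨_, hT⟩ = h x.shift T := by
  open CuntzKriegerBimodule HilbertBimodule in
  obtain ⟨e, he⟩ := exists_homeomorph_characterSpace_diagonal hA hfp
  have := isClosed_diagonal (A := A) (X := X)
  refine ⟨fun T hT T' hT' => diagonal_mul_comm hfp hT hT', e.symm.compactSpace, e,
    fun i => ?_, fun n u hu T => ⟨sigma_mem_diagonal hu T.2, fun x => homeomorph_sigma he hu x T⟩⟩
  -- As `p_i = r_0(p_i)`, it lies in `𝒟_A` and reads off the initial entry of the itinerary, which
  -- has index `0` here.
  rw [← CuntzPimsner.r_zero (p_mem_center i) hfp]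
  refine ⟨r_mem_diagonal 0 i, fun x => ?_⟩
  rw [he]
  by_cases hx : x.1 0 = i
  · rw [if_pos hx, Set.indicator_of_mem (s := MarkovSpace.cylinder _ i) hx]
  · rw [if_neg hx, Set.indicator_of_notMem (s := MarkovSpace.cylinder _ i) hx]
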